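/- Fix a real number $\alpha>0$. On the doubly slit plane $\mathcal H=\mathbb C\setminus\big((-\infty,-\tfrac\pi2)\cup(\tfrac\pi2,\infty)\big)$ let powers of $\cos$ be taken with the branch equal to $1$ at $0$, and put $$\tilde F(x)=\int_{-\pi/2}^{x}(\cos y)^{\alpha-1}\,dy ,\qquad x\in\mathcal H ,$$ the integral being along any contour in $\mathcal H$. For $\nu,\kappa\in\mathbb C$ with $\nu-\kappa\in\mathbb N_0=\{0,1,2,\dots\}$ let $$\tilde B\{\nu,\kappa\}=\frac{\alpha^{\nu-\kappa}}{\Gamma(\kappa)(\nu-\kappa)!}\int_{-\pi/2}^{\pi/2}(\cos x)^{\alpha\kappa-1}(\tilde F(x))^{\nu-\kappa}\,dx\qquad(\operatorname{Re}\kappa>0),$$ $$\tilde A[\nu,\kappa]=\frac{\alpha^{\nu-\kappa+1}}{(\nu-\kappa)!}\cdot\frac{\Gamma(\nu+1)}{2\pi i}\int_{-i\infty}^{+i\infty}(\cos x)^{-\alpha\nu-1}(\tilde F(x))^{\nu-\kappa}\,dx\qquad(\operatorname{Re}\kappa>-\tfrac1\alpha,\ -(\nu+1)\notin\mathbb N_0).$$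 These integrals converge absolutely (the second one for all $\kappa$ with $\operatorname{Re}\kappa>-\frac1\alpha$), and for each fixed value of $\nu-\kappa\in\mathbb N_0$ the functions $\tilde B\{\nu,\kappa\}$ and $\tilde A[\nu,\kappa]$ extend (uniquely) to meromorphic functions of $\kappa\in\mathbb C$, denoted by the same symbols. Let $n,d,k\in\mathbb C$ be such that $n-d\in\mathbb N_0$ and $d-k\in\mathbb N_0$ are arbitrary but fixed. Then the following equalities of meromorphic functions of the complex variable $k$ (equivalently, of $n$) hold: $$\sum_{\substack{s\in\{0,2,4,\dots\},\ s\le d-k\\ m:=d-s}}\tilde B\{n,m\}\,\frac{\left(m-\frac1\alpha\right)\Gamma(m)}{\Gamma\left(m+1-\frac2\alpha\right)}\,\tilde A\left[m-\tfrac2\alpha,k-\tfrac2\alpha\right]=\sum_{\substack{q\in\{0,2,4,\dots\}\\ q\le d-k}}\tilde B\left\{n+\tfrac q\alpha,d-q+\tfrac q\alpha\right\}\tilde A\left[d-q+\tfrac q\alpha,k+\tfrac q\alpha\right],$$ $$\sum_{\substack{s\in\{2,4,6,\dots\},\ s\le n-d\\ m:=d+s}}\tilde B\{n,m\}\,\frac{\left(m-\frac1\alpha\right)\Gamma(m)}{\Gamma\left(m+1-\frac2\alpha\right)}\,\tilde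 A\left[m-\tfrac2\alpha,k-\tfrac2\alpha\right]=\sum_{\substack{q\in\{2,4,6,\dots\}\\ q\le n-d}}\tilde B\left\{n-\tfrac q\alpha,d+q-\tfrac q\alpha\right\}\tilde A\left[d+q-\tfrac q\alpha,k-\tfrac q\alpha\right].$$ -/

import Mathlib

noncomputable section

namespace BetaPrime

/-- The branch of `log (cos x)` on the doubly slit plane
`ℂ \ ((-∞, -π/2) ∪ (π/2, ∞))` (where it is finite, that is for `x ≠ ± π/2`) that vanishes at `x = 0`:
the integral of its derivative `-tan` along the segment from `0` to `x`. -/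
def logCos (x : ℂ) : ℂ :=
  -(x * ∫ t in (0 : ℝ)..1, Complex.tan ((t : ℂ) * x))

/-- The branch of `(cos x) ^ s` on the doubly slit plane that equals `1` at `x = 0`. -/
def cosPow (s x : ℂ) : ℂ :=
  Complex.exp (s * logCos x)

/-- On the strip `|Re x| < π/2`, which contains the real interval and the imaginary axis on which
the functions are integrated below, the branch is the principal one. -/
theorem logCos_eq_log_cos (x : ℂ) (hx : |x.re| < Real.pi / 2) :
    logCos x = Complex.log (Complex.cos x) := by
  have hre : ∀ t ∈ Set.uIcc (0 : ℝ) 1, 0 < (Complex.cos ((t : ℂ) * x)).re := by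
    intro t ht
    rw [Set.uIcc_of_le zero_le_one] at ht
    have h1 : |t * x.re| < Real.pi / 2 := by
      rw [abs_mul, abs_of_nonneg ht.1]
      exact lt_of_le_of_lt (mul_le_of_le_one_left (abs_nonneg _) ht.2) hx
    rw [abs_lt] at h1
    rw [Complex.cos_eq]
    have h2 := Real.cos_pos_of_mem_Ioo (x := t * x.re) ⟨by linarith [h1.1], h1.2⟩
    have h3 := Real.cosh_pos (t * x.im)
    have e1 : ((t : ℂ) * x).re = t * x.re := by simp
    have e2 : ((t : ℂ) * x).im = t * x.im := by simp
    rw [e1, e2]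
    rw [← Complex.ofReal_cos, ← Complex.ofReal_cosh, ← Complex.ofReal_sin, ← Complex.ofReal_sinh]
    simp only [Complex.sub_re, Complex.mul_re, Complex.ofReal_re, Complex.ofReal_im,
      Complex.mul_im, Complex.I_re, Complex.I_im]
    nlinarith [mul_pos h2 h3]
  have hne : ∀ t ∈ Set.uIcc (0 : ℝ) 1, Complex.cos ((t : ℂ) * x) ≠ 0 := by
    intro t ht h0
    have := hre t ht
    rw [h0] at this
    simp at this
  have hd : ∀ t ∈ Set.uIcc (0 : ℝ) 1,
      HasDerivAt (fun t : ℝ => Complex.log (Complex.cos ((t : ℂ) * x)))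
        (-(x * Complex.tan ((t : ℂ) * x))) t := by
    intro t ht
    have h1 : HasDerivAt (fun t : ℝ => (t : ℂ) * x) x t := by
      simpa using (Complex.ofRealCLM.hasDerivAt (x := t)).mul_const x
    have h0 : HasDerivAt (fun t : ℝ => Complex.cos ((t : ℂ) * x))
        (-Complex.sin ((t : ℂ) * x) * x) t :=
      HasDerivAt.comp (h₂ := Complex.cos) t (Complex.hasDerivAt_cos ((t : ℂ) * x)) h1
    have h2 := h0.clog_real (Or.inl (hre t ht))
    convert h2 using 1
    rw [Complex.tan_eq_sin_div_cos]
    ring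
  have hc : ContinuousOn (fun t : ℝ => -(x * Complex.tan ((t : ℂ) * x))) (Set.uIcc (0 : ℝ) 1) := by
    intro t ht
    refine ContinuousAt.continuousWithinAt ?_
    refine (continuousAt_const.mul ?_).neg
    exact ContinuousAt.comp (f := fun t : ℝ => (t : ℂ) * x)
      (Complex.continuousAt_tan.2 (hne t ht)) (by fun_prop)
  have key := intervalIntegral.integral_eq_sub_of_hasDerivAt hd hc.intervalIntegrable
  rw [intervalIntegral.integral_neg, intervalIntegral.integral_const_mul] at key
  rw [logCos, key]
  simp

/-- `Ftilde α x = ∫_{-π/2}^x (cos y) ^ (α - 1) dy` on the doubly slit plane.  The contour is the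
polygon `-π/2 → 0 → i Im x → x`, which stays in the doubly slit plane for every `x` of that
plane; the integral does not depend on the choice of the contour. -/
def Ftilde (α : ℝ) (x : ℂ) : ℂ :=
  (∫ t in (-(Real.pi / 2))..(0 : ℝ), cosPow ((α : ℂ) - 1) (t : ℂ))
    + Complex.I * (∫ t in (0 : ℝ)..x.im, cosPow ((α : ℂ) - 1) (Complex.I * (t : ℂ)))
    + ∫ t in (0 : ℝ)..x.re, cosPow ((α : ℂ) - 1) ((t : ℂ) + Complex.I * (x.im : ℂ))

/-- The integrand `(cos x) ^ (α κ - 1) (F x) ^ N` of the `B`-quantities, `N = ν - κ`. -/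
def integrandB (α : ℝ) (N : ℕ) (κ : ℂ) (x : ℝ) : ℂ :=
  cosPow ((α : ℂ) * κ - 1) (x : ℂ) * Ftilde α (x : ℂ) ^ N

/-- The integral formula for `B{ν, κ}`, `ν = κ + N`. -/
def integralB (α : ℝ) (N : ℕ) (κ : ℂ) : ℂ :=
  (α : ℂ) ^ N / (Complex.Gamma κ * (N.factorial : ℂ))
    * ∫ x in (-(Real.pi / 2))..(Real.pi / 2), integrandB α N κ x

/-- The integrand `(cos x) ^ (-α ν - 1) (F x) ^ N` of the `A`-quantities at the point `x = i y` of
the imaginary axis, `ν = κ + N`. -/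
def integrandA (α : ℝ) (N : ℕ) (κ : ℂ) (y : ℝ) : ℂ :=
  cosPow (-(α : ℂ) * (κ + N) - 1) (Complex.I * (y : ℂ)) * Ftilde α (Complex.I * (y : ℂ)) ^ N

/-- The integral formula for `A[ν, κ]`, `ν = κ + N`; along the imaginary axis `dx = i dy`. -/
def integralA (α : ℝ) (N : ℕ) (κ : ℂ) : ℂ :=
  (α : ℂ) ^ (N + 1) / (N.factorial : ℂ)
    * (Complex.Gamma (κ + N + 1) / (2 * (Real.pi : ℂ) * Complex.I))
    * (Complex.I * ∫ y : ℝ, integrandA α N κ y)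

/-- The half-plane on which the integral formula for `B{κ + N, κ}` is used. -/
def domainB : Set ℂ := {κ | 0 < κ.re}

/-- The half-plane `Re κ > -1/α`, on which the integral for `A[κ + N, κ]` converges absolutely,
without the poles of the factor `Γ(ν + 1) = Γ(κ + N + 1)`. -/
def domainA (α : ℝ) (N : ℕ) : Set ℂ :=
  {κ | -(1 / α) < κ.re ∧ ∀ j : ℕ, κ + N + 1 ≠ -(j : ℂ)}

/-- `g` is a meromorphic function on `ℂ` (in normal form: its value at a removable singularity is
the limit, its value at a pole is `0`) that extends the restriction of `f` to `U`.  If `U` is open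
and nonempty, there is at most one such `g`. -/
def IsMeromorphicExtension (U : Set ℂ) (f g : ℂ → ℂ) : Prop :=
  MeromorphicNFOn g Set.univ ∧ Set.EqOn g f U

open Classical in
/-- The meromorphic extension of `f|_U` to `ℂ` (and `0` if there is none). -/
def meromorphicExtension (U : Set ℂ) (f : ℂ → ℂ) : ℂ → ℂ :=
  if h : ∃ g, IsMeromorphicExtension U f g then Classical.choose h else 0

open Classical in
/-- `B{ν, κ}`: for fixed `ν - κ = N ∈ ℕ` the meromorphic extension in `κ` of the integral formula;
`0` if `ν - κ` is not a nonnegative integer. -/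
def tildeB (α : ℝ) (ν κ : ℂ) : ℂ :=
  if h : ∃ N : ℕ, ν - κ = (N : ℂ) then
    meromorphicExtension domainB (integralB α (Classical.choose h)) κ
  else 0

open Classical in
/-- `A[ν, κ]`: for fixed `ν - κ = N ∈ ℕ` the meromorphic extension in `κ` of the integral formula;
`0` if `ν - κ` is not a nonnegative integer. -/
def tildeA (α : ℝ) (ν κ : ℂ) : ℂ :=
  if h : ∃ N : ℕ, ν - κ = (N : ℂ) then
    meromorphicExtension (domainA α (Classical.choose h)) (integralA α (Classical.choose h)) κ
  else 0

/-- `f` and `g` are meromorphic on `ℂ` and equal as meromorphic functions, that is, they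
have the same values outside a closed discrete set. -/
def EqAsMeromorphic (f g : ℂ → ℂ) : Prop :=
  MeromorphicOn f Set.univ ∧ MeromorphicOn g Set.univ ∧ f =ᶠ[Filter.codiscrete ℂ] g

end BetaPrime

end

/-!
The integrands of `B{ν, κ}` and of `A[ν, κ]` both have the form `(cos x) ^ s (F x) ^ n` with
`n = ν - κ`, on the real and on the imaginary axis.  Since `F' = (cos x) ^ (α - 1)`, integrating the
derivative of

  `sin x (cos x) ^ p (F x) ^ n + n / (p + α) (cos x) ^ (p + α) (F x) ^ (n - 1)`

relates the moments of `F ^ n` for `s = p ± 1` to the moment of `F ^ (n - 2)` for `s = p + 2 α - 1`.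
This recurrence continues the moments to meromorphic functions of `s`.  In terms of
`b i P = Γ(P) B{P + i, P}` and `a j Q = A[Q, Q - j] / Γ(Q + 1)` it reads

  `P b i P - (P + 1/α) b i (P + 2/α) = b (i - 2) (P + 2) / (P + 1)`,
  `Q a j Q - (Q - 1/α) a j (Q - 2/α) = a (j - 2) (Q - 2) / (Q - 1)`,

where the right-hand sides are `0` for `i < 2` and `j < 2`.  The summands on both sides of the two
identities are values of `T i j P Q = (P + Q) / 2 * b i P * a j Q`, with `Q = P - 2/α` on the left
and `Q = P` on the right.  By the second recurrence, the change of `T i j P Q` between `Q = P - 2/α`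
and `Q = P` is `b i P * a (j - 2) (P - 2) / (P - 1)`; by the first one, this is also the change of
`T (i + 2) (j - 2) P' (P - 2)` between `P' = P - 2 + 2/α` and `P' = P - 2`.  So both sums telescope
against each other, `P` moving by `2/α` from each summand to the next.
-/

noncomputable section

namespace BetaPrime

open Filter Topology Set MeasureTheory

/-! ### Meromorphic functions and generic points -/

theorem eventually_codiscrete_iff {X : Type*} [TopologicalSpace X] {p : X → Prop} :
    (∀ᶠ x in codiscrete X, p x) ↔ ∀ x, ∀ᶠ y in 𝓝[≠] x, p y := by
  simp only [Filter.Eventually, mem_codiscrete, disjoint_principal_right, compl_compl]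

theorem tendsto_codiscrete_of_injective {X Y : Type*} [TopologicalSpace X] [TopologicalSpace Y]
    {f : X → Y} (hf : Continuous f) (hinj : f.Injective) :
    Tendsto f (codiscrete X) (codiscrete Y) := fun s hs ↦ by
  refine eventually_codiscrete_iff.2 fun x ↦ ?_
  have hne : Tendsto f (𝓝[≠] x) (𝓝[≠] f x) :=
    hf.continuousAt.tendsto.inf (tendsto_principal_principal.2 fun _ ↦ hinj.ne)
  exact hne.eventually (eventually_codiscrete_iff.1 hs (f x))

theorem tendsto_add_const_codiscrete (c : ℂ) :
    Tendsto (· + c) (codiscrete ℂ) (codiscrete ℂ) :=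
  tendsto_codiscrete_of_injective (by fun_prop) (add_left_injective c)

theorem eventually_codiscrete_ne {X : Type*} [TopologicalSpace X] [T1Space X] (c : X) :
    ∀ᶠ x in codiscrete X, x ≠ c :=
  (finite_singleton c).compl_mem_codiscrete

theorem eventually_codiscrete_eq_of_eqOn {𝕜 E : Type*} [RCLike 𝕜] [NormedAddCommGroup E]
    [NormedSpace 𝕜 E] {f g : 𝕜 → E} {U : Set 𝕜} (hf : Meromorphic f) (hg : Meromorphic g)
    (hU : IsOpen U) (hne : U.Nonempty) (h : EqOn f g U) :
    f =ᶠ[codiscrete 𝕜] g := by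
  obtain ⟨u, hu⟩ := hne
  have htop : meromorphicOrderAt (f - g) u = ⊤ := by
    refine meromorphicOrderAt_eq_top_iff.2 (Eventually.filter_mono nhdsWithin_le_nhds ?_)
    filter_upwards [hU.mem_nhds hu] with z hz using sub_eq_zero.2 (h hz)
  refine eventually_codiscrete_iff.2 fun x ↦ ?_
  have hx : meromorphicOrderAt (f - g) x = ⊤ := by
    by_contra hx
    exact (hf.sub hg).exists_meromorphicOrderAt_ne_top_iff_forall.1 ⟨x, hx⟩ u htop
  filter_upwards [meromorphicOrderAt_eq_top_iff.1 hx] with z hz using sub_eq_zero.1 hz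

theorem eventually_codiscrete_Gamma_ne_zero : ∀ᶠ z in codiscrete ℂ, Complex.Gamma z ≠ 0 := by
  have hΓ : AnalyticOnNhd ℂ (fun z ↦ (Complex.Gamma z)⁻¹) univ :=
    Complex.analyticOnNhd_univ_iff_differentiable.2 Complex.differentiable_one_div_Gamma
  filter_upwards [hΓ.preimage_zero_mem_codiscrete (x := 1) (by simp)] with z hz
  simpa using hz

/-- The iterates of the functional equation `f z = r z * f (z + δ) + h z`. -/
def shiftIterate {𝕜 : Type*} [Semiring 𝕜] (f r h : 𝕜 → 𝕜) (δ : 𝕜) : ℕ → 𝕜 → 𝕜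
  | 0, z => f z
  | n + 1, z => r z * shiftIterate f r h δ n (z + δ) + h z

section Shift

variable {𝕜 : Type*} [NontriviallyNormedField 𝕜] {f r h : 𝕜 → 𝕜} {U : Set 𝕜} {δ : 𝕜}

theorem meromorphicAt_shiftIterate (hf : MeromorphicOn f U) (hr : Meromorphic r)
    (hh : Meromorphic h) (n : ℕ) {z : 𝕜} (hz : z + n * δ ∈ U) :
    MeromorphicAt (shiftIterate f r h δ n) z := by
  induction n generalizing z with
  | zero => exact hf z (by simpa using hz)
  | succ n ih =>
    have hz' : MeromorphicAt (fun w ↦ shiftIterate f r h δ n (w + δ)) z :=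
      meromorphicAt_fun_comp_add_const_iff_meromorphicAt.2
        (ih (by convert hz using 1; push_cast; ring))
    exact ((hr z).fun_mul hz').fun_add (hh z)

theorem shiftIterate_eq_of_le (hshift : ∀ z ∈ U, z + δ ∈ U)
    (heq : ∀ z ∈ U, f z = r z * f (z + δ) + h z) {m n : ℕ} (hmn : m ≤ n) {z : 𝕜}
    (hz : z + m * δ ∈ U) : shiftIterate f r h δ n z = shiftIterate f r h δ m z := by
  have hsucc (k : ℕ) {z : 𝕜} (hz : z + k * δ ∈ U) :
      shiftIterate f r h δ (k + 1) z = shiftIterate f r h δ k z := by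
    induction k generalizing z with
    | zero => exact (heq z (by simpa using hz)).symm
    | succ k ih =>
      have hz' := ih (z := z + δ) (by convert hz using 1; push_cast; ring)
      rw [shiftIterate, hz', shiftIterate]
  have hmem (k : ℕ) (hk : m ≤ k) : z + k * δ ∈ U := by
    induction k, hk using Nat.le_induction with
    | base => exact hz
    | succ k _ ih => convert hshift _ ih using 1; push_cast; ring
  induction n, hmn using Nat.le_induction with
  | base => rfl
  | succ n hn ih => rw [hsucc n (hmem n hn), ih]

open Classical in
theorem exists_meromorphic_eqOn_of_shift (hU : IsOpen U) (hshift : ∀ z ∈ U, z + δ ∈ U)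
    (hreach : ∀ z, ∃ n : ℕ, z + n * δ ∈ U) (hf : MeromorphicOn f U) (hr : Meromorphic r)
    (hh : Meromorphic h) (heq : ∀ z ∈ U, f z = r z * f (z + δ) + h z) :
    ∃ g : 𝕜 → 𝕜, Meromorphic g ∧ EqOn g f U := by
  let g : 𝕜 → 𝕜 := fun z ↦ shiftIterate f r h δ (Nat.find (hreach z)) z
  have hg (n : ℕ) {z : 𝕜} (hz : z + n * δ ∈ U) : g z = shiftIterate f r h δ n z :=
    (shiftIterate_eq_of_le hshift heq (Nat.find_min' _ hz) (Nat.find_spec (hreach z))).symm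
  refine ⟨g, fun z ↦ ?_, fun z hz ↦ hg 0 (by simpa using hz)⟩
  obtain ⟨n, hn⟩ := hreach z
  refine (meromorphicAt_shiftIterate hf hr hh n hn).congr
    (Eventually.filter_mono nhdsWithin_le_nhds ?_)
  have hopen : IsOpen {w : 𝕜 | w + n * δ ∈ U} := hU.preimage (by fun_prop)
  filter_upwards [hopen.mem_nhds hn] with w hw using (hg n hw).symm

theorem exists_meromorphic_eqOn_of_recurrence {F : ℕ → 𝕜 → 𝕜} {U : ℕ → Set 𝕜} {q : 𝕜 → 𝕜} {c : 𝕜}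
    {d : ℕ} (hd : 0 < d) (hU : ∀ n, IsOpen (U n)) (hshift : ∀ n, ∀ z ∈ U n, z + δ ∈ U n)
    (hreach : ∀ n z, ∃ m : ℕ, z + m * δ ∈ U n) (hF : ∀ n, MeromorphicOn (F n) (U n))
    (hr : Meromorphic r) (hq : Meromorphic q)
    (hlower : ∀ n, d ≤ n → ∀ z ∈ U n, z + c ∈ U (n - d))
    (heq : ∀ n, ∀ z ∈ U n,
      F n z = r z * F n (z + δ) + if d ≤ n then q z * F (n - d) (z + c) else 0) (n : ℕ) :
    ∃ g : 𝕜 → 𝕜, Meromorphic g ∧ EqOn g (F n) (U n) := by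
  induction n using Nat.strong_induction_on with | _ n ih
  by_cases hn : d ≤ n
  · obtain ⟨g, hg, hgF⟩ := ih (n - d) (by omega)
    refine exists_meromorphic_eqOn_of_shift (h := fun z ↦ q z * g (z + c)) (hU n) (hshift n)
      (hreach n) (hF n) hr (fun x ↦ by fun_prop) fun z hz ↦ ?_
    rw [heq n z hz, if_pos hn, hgF (hlower n hn z hz)]
  · refine exists_meromorphic_eqOn_of_shift (h := fun _ ↦ 0) (hU n) (hshift n)
      (hreach n) (hF n) hr (fun x ↦ by fun_prop) fun z hz ↦ ?_
    rw [heq n z hz, if_neg hn]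

end Shift

theorem isMeromorphicExtension_meromorphicExtension {f g : ℂ → ℂ} {U : Set ℂ}
    (hg : Meromorphic g) (hfg : EqOn g f U) (hcont : ∀ z ∈ U, ContinuousAt g z) :
    IsMeromorphicExtension U f (meromorphicExtension U f) := by
  have hex : ∃ g, IsMeromorphicExtension U f g := by
    refine ⟨toMeromorphicNFOn g univ, meromorphicNFOn_toMeromorphicNFOn g univ, fun z hz ↦ ?_⟩
    have hNF : MeromorphicNFAt g z := ((hg z).analyticAt (hcont z hz)).meromorphicNFAt
    rw [toMeromorphicNFOn_eq_toMeromorphicNFAt (meromorphicOn_univ.2 hg) (mem_univ z),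
      toMeromorphicNFAt_eq_self.2 hNF, hfg hz]
  simpa only [meromorphicExtension, dif_pos hex] using Classical.choose_spec hex

theorem tildeB_add_natCast (α : ℝ) (N : ℕ) (κ : ℂ) :
    tildeB α (κ + N) κ = meromorphicExtension domainB (integralB α N) κ := by
  have hex : ∃ M : ℕ, κ + N - κ = (M : ℂ) := ⟨N, by ring⟩
  have hN : Classical.choose hex = N := by
    exact_mod_cast (Classical.choose_spec hex).symm.trans (add_sub_cancel_left κ (N : ℂ))
  rw [tildeB, dif_pos hex, hN]

theorem tildeA_add_natCast (α : ℝ) (N : ℕ) (κ : ℂ) :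
    tildeA α (κ + N) κ = meromorphicExtension (domainA α N) (integralA α N) κ := by
  have hex : ∃ M : ℕ, κ + N - κ = (M : ℂ) := ⟨N, by ring⟩
  have hN : Classical.choose hex = N := by
    exact_mod_cast (Classical.choose_spec hex).symm.trans (add_sub_cancel_left κ (N : ℂ))
  rw [tildeA, dif_pos hex, hN]

/-! ### Telescoping along a diagonal -/

theorem eventually_sum_eq_sum_diagonal {X A : Type*} [AddMonoid X] [AddCommGroup A] {l : Filter X}
    {c : X} (hl : Tendsto (· + c) l l) (n : ℕ) (u v : ℕ → X → A)
    (hstep : ∀ t, t + 1 < n →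
      ∀ᶠ x in l, u t x - v t x = u (t + 1) (x + c) - v (t + 1) x)
    (hlast : ∀ t, t + 1 = n → ∀ᶠ x in l, u t x = v t x) :
    ∀ᶠ x in l, ∑ t ∈ Finset.range n, u t x = ∑ t ∈ Finset.range n, v t (x + t • c) := by
  induction n generalizing u v with
  | zero => simp
  | succ n ih =>
    have htail := ih (fun t ↦ u (t + 1)) (fun t ↦ v (t + 1))
      (fun t ht ↦ hstep (t + 1) (by omega)) (fun t ht ↦ hlast (t + 1) (by omega))
    have hsteps : ∀ᶠ x in l, ∀ t ∈ Finset.range n,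
        u t x - v t x = u (t + 1) (x + c) - v (t + 1) x :=
      (Finset.range n).eventually_all.2 fun t ht ↦ hstep t (by simpa using ht)
    filter_upwards [hl.eventually htail, hsteps, hlast n rfl] with x htail hsteps hlast
    calc ∑ t ∈ Finset.range (n + 1), u t x
      _ = ∑ t ∈ Finset.range (n + 1), v t x + ∑ t ∈ Finset.range (n + 1), (u t x - v t x) := by
        rw [Finset.sum_sub_distrib, add_sub_cancel]
      _ = ∑ t ∈ Finset.range n, v (t + 1) x + v 0 x +
          ∑ t ∈ Finset.range n, (u (t + 1) (x + c) - v (t + 1) x) := by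
        rw [Finset.sum_range_succ', Finset.sum_range_succ (fun t ↦ u t x - v t x),
          Finset.sum_congr rfl hsteps, hlast, sub_self, add_zero]
      _ = ∑ t ∈ Finset.range n, u (t + 1) (x + c) + v 0 x := by
        rw [Finset.sum_sub_distrib]; abel
      _ = ∑ t ∈ Finset.range (n + 1), v t (x + t • c) := by
        rw [htail, Finset.sum_range_succ']
        simp only [zero_smul, add_zero, succ_nsmul', add_assoc]

theorem sum_filter_even_range {A : Type*} [AddCommMonoid A] (n : ℕ) (f : ℕ → A) :
    ∑ s ∈ (Finset.range (n + 1)).filter Even, f s =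
      ∑ t ∈ Finset.range (n / 2 + 1), f (2 * t) := by
  refine Finset.sum_nbij' (· / 2) (2 * ·) ?_ ?_ ?_ ?_ ?_ <;>
    simp only [Finset.mem_filter, Finset.mem_range, Nat.even_iff] <;> intro s hs
  all_goals first | omega | (congr 1; omega)

theorem sum_filter_even_Icc_two {A : Type*} [AddCommMonoid A] (n : ℕ) (f : ℕ → A) :
    ∑ s ∈ (Finset.Icc 2 n).filter Even, f s =
      ∑ t ∈ Finset.range (n / 2), f (2 * (t + 1)) := by
  refine Finset.sum_nbij' (fun s ↦ s / 2 - 1) (fun t ↦ 2 * (t + 1)) ?_ ?_ ?_ ?_ ?_ <;>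
    simp only [Finset.mem_filter, Finset.mem_range, Finset.mem_Icc, Nat.even_iff] <;> intro s hs
  all_goals first | omega | (congr 1; omega)

/-! ### Integrals of complex powers depending on the exponent -/

theorem rpow_le_rpow_add_rpow {c a b d : ℝ} (hc : 0 < c) (hab : a ≤ b) (hbd : b ≤ d) :
    c ^ b ≤ c ^ a + c ^ d := by
  rcases le_total c 1 with h | h
  · exact (Real.rpow_le_rpow_of_exponent_ge hc h hab).trans
      (le_add_of_nonneg_right (Real.rpow_nonneg hc.le d))
  · exact (Real.rpow_le_rpow_of_exponent_le h hbd).trans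
      (le_add_of_nonneg_left (Real.rpow_nonneg hc.le a))

theorem abs_log_le_rpow_add_rpow_neg_div {c ε : ℝ} (hc : 0 < c) (hε : 0 < ε) :
    |Real.log c| ≤ (c ^ ε + c ^ (-ε)) / ε := by
  have hlog : Real.log c ≤ c ^ ε / ε := Real.log_le_rpow_div hc.le hε
  have hlog_inv : -Real.log c ≤ c ^ (-ε) / ε := by
    simpa only [Real.log_inv, Real.inv_rpow hc.le, ← Real.rpow_neg hc.le] using
      Real.log_le_rpow_div (inv_pos.2 hc).le hε
  rw [add_div, abs_le]
  constructor <;> linarith [div_nonneg (Real.rpow_nonneg hc.le ε) hε.le,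
    div_nonneg (Real.rpow_nonneg hc.le (-ε)) hε.le]

theorem abs_log_mul_rpow_le {c σ τ ε : ℝ} (hc : 0 < c) (hε : 0 < ε) (hτ : |τ - σ| < ε) :
    |Real.log c| * c ^ τ ≤ 2 / ε * (c ^ (σ - 2 * ε) + c ^ (σ + 2 * ε)) := by
  rw [abs_lt] at hτ
  calc |Real.log c| * c ^ τ
    _ ≤ (c ^ ε + c ^ (-ε)) / ε * c ^ τ := by
      gcongr; exact abs_log_le_rpow_add_rpow_neg_div hc hε
    _ = (c ^ (τ + ε) + c ^ (τ - ε)) / ε := by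
      rw [Real.rpow_add hc, sub_eq_add_neg, Real.rpow_add hc]; ring
    _ ≤ ((c ^ (σ - 2 * ε) + c ^ (σ + 2 * ε)) + (c ^ (σ - 2 * ε) + c ^ (σ + 2 * ε))) / ε := by
      gcongr <;> exact rpow_le_rpow_add_rpow hc (by linarith) (by linarith)
    _ = 2 / ε * (c ^ (σ - 2 * ε) + c ^ (σ + 2 * ε)) := by ring

theorem differentiableOn_integral_cpow_mul {T : Type*} [MeasurableSpace T] {μ : Measure T}
    {c : T → ℝ} {φ : T → ℂ} {I : Set ℝ} (hI : IsOpen I) (hc : AEMeasurable c μ)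
    (hpos : ∀ᵐ t ∂μ, 0 < c t)
    (hint : ∀ z : ℂ, z.re ∈ I → Integrable (fun t ↦ (c t : ℂ) ^ z * φ t) μ) :
    DifferentiableOn ℂ (fun z : ℂ ↦ ∫ t, (c t : ℂ) ^ z * φ t ∂μ) {z | z.re ∈ I} := by
  intro z hz
  obtain ⟨ε, hε, hεI⟩ : ∃ ε > 0, ∀ τ, |τ - z.re| ≤ 2 * ε → τ ∈ I := by
    obtain ⟨r, hr, hrI⟩ := Metric.isOpen_iff.1 hI z.re hz
    refine ⟨r / 3, by positivity, fun τ hτ ↦ hrI ?_⟩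
    rw [Metric.mem_ball, Real.dist_eq]
    linarith
  let s : Set ℂ := {w | |w.re - z.re| < ε}
  have hs : s ∈ 𝓝 z :=
    (isOpen_lt (by fun_prop) continuous_const).mem_nhds (by simpa using hε)
  have hbound : Integrable (fun t ↦ 2 / ε *
      (‖(c t : ℂ) ^ (z - 2 * (ε : ℂ)) * φ t‖ + ‖(c t : ℂ) ^ (z + 2 * (ε : ℂ)) * φ t‖)) μ := by
    refine ((hint _ (hεI _ ?_)).norm.add (hint _ (hεI _ ?_)).norm).const_mul _ <;>
      simp [abs_of_pos hε]
  have hderiv := hasDerivAt_integral_of_dominated_loc_of_deriv_le (μ := μ) (𝕜 := ℂ) (x₀ := z)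
    (F := fun w t ↦ (c t : ℂ) ^ w * φ t)
    (F' := fun w t ↦ (Real.log (c t) : ℂ) * ((c t : ℂ) ^ w * φ t)) hs
    (Filter.eventually_of_mem hs fun w hw ↦
      (hint w (hεI _ (by have : |w.re - z.re| < ε := hw; linarith))).aestronglyMeasurable)
    (hint z hz)
    ((Complex.measurable_ofReal.comp_aemeasurable
      (Real.measurable_log.comp_aemeasurable hc)).aestronglyMeasurable.mul
      (hint z hz).aestronglyMeasurable)
    (hpos.mono fun t ht w hw ↦ ?_) hbound (hpos.mono fun t ht w _ ↦ ?_)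
  · exact hderiv.2.differentiableAt.differentiableWithinAt
  · simp only [norm_mul, Complex.norm_real, Real.norm_eq_abs,
      Complex.norm_cpow_eq_rpow_re_of_pos ht, ← add_mul, ← mul_assoc]
    refine mul_le_mul_of_nonneg_right ?_ (norm_nonneg _)
    simpa using abs_log_mul_rpow_le ht hε hw
  · have ht' : (c t : ℂ) ≠ 0 := by exact_mod_cast ht.ne'
    refine (((hasDerivAt_id w).const_cpow (Or.inl ht')).mul_const (φ t)).congr_deriv ?_
    rw [Complex.ofReal_log ht.le, id]
    ring

/-! ### Powers of the cosine on the strip `|Re x| < π / 2` -/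

theorem re_cos_pos {x : ℂ} (hx : |x.re| < Real.pi / 2) : 0 < (Complex.cos x).re := by
  have hre : (Complex.cos x).re = Real.cos x.re * Real.cosh x.im := by
    simp [Complex.cos_eq x, Complex.cos_ofReal_re, Complex.cosh_ofReal_re,
      Complex.cos_ofReal_im, Complex.sin_ofReal_im, Complex.sinh_ofReal_im]
  exact hre ▸ mul_pos (Real.cos_pos_of_mem_Ioo (abs_lt.1 hx)) (Real.cosh_pos _)

theorem cosPow_eq_cpow (s : ℂ) {x : ℂ} (hx : |x.re| < Real.pi / 2) :
    cosPow s x = Complex.cos x ^ s := by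
  have hne : Complex.cos x ≠ 0 := fun h ↦ by simpa [h] using re_cos_pos hx
  rw [cosPow, logCos_eq_log_cos x hx, Complex.cpow_def_of_ne_zero hne, mul_comm]

theorem cosPow_add (s s' x : ℂ) : cosPow (s + s') x = cosPow s x * cosPow s' x := by
  rw [cosPow, cosPow, cosPow, ← Complex.exp_add, add_mul]

theorem cosPow_one {x : ℂ} (hx : |x.re| < Real.pi / 2) : cosPow 1 x = Complex.cos x := by
  rw [cosPow_eq_cpow 1 hx, Complex.cpow_one]

theorem hasDerivAt_cosPow (s : ℂ) {x : ℂ} (hx : |x.re| < Real.pi / 2) :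
    HasDerivAt (cosPow s) (-(s * Complex.sin x * cosPow (s - 1) x)) x := by
  have hpow : HasDerivAt (fun y ↦ Complex.cos y ^ s)
      (-(s * Complex.sin x * cosPow (s - 1) x)) x := by
    refine ((Complex.hasDerivAt_cos x).cpow_const (Or.inl (re_cos_pos hx))).congr_deriv ?_
    rw [cosPow_eq_cpow _ hx]
    ring
  have hopen : IsOpen {y : ℂ | |y.re| < Real.pi / 2} :=
    isOpen_lt (by fun_prop) continuous_const
  refine hpow.congr_of_eventuallyEq ?_
  filter_upwards [hopen.mem_nhds hx] with y hy using cosPow_eq_cpow s hy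

theorem cosPow_ofReal (s : ℂ) {x : ℝ} (hx : |x| < Real.pi / 2) :
    cosPow s x = (Real.cos x : ℂ) ^ s := by
  rw [cosPow_eq_cpow s (by simpa using hx), Complex.ofReal_cos]

theorem cosPow_I_mul (s : ℂ) (y : ℝ) : cosPow s (Complex.I * y) = (Real.cosh y : ℂ) ^ s := by
  rw [cosPow_eq_cpow s (by simpa using Real.pi_pos), mul_comm, Complex.cos_mul_I,
    Complex.ofReal_cosh]

theorem norm_cosPow_ofReal (s : ℂ) {x : ℝ} (hx : |x| < Real.pi / 2) :
    ‖cosPow s x‖ = Real.cos x ^ s.re := by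
  rw [cosPow_ofReal s hx,
    Complex.norm_cpow_eq_rpow_re_of_pos (Real.cos_pos_of_mem_Ioo (abs_lt.1 hx))]

theorem norm_cosPow_I_mul (s : ℂ) (y : ℝ) :
    ‖cosPow s (Complex.I * y)‖ = Real.cosh y ^ s.re := by
  rw [cosPow_I_mul, Complex.norm_cpow_eq_rpow_re_of_pos (Real.cosh_pos y)]

/-! ### The moment integrands and their common antiderivative -/

/-- The integrand `(cos x) ^ s (F x) ^ n` shared by the `B`-integrals, where `s = α κ - 1`, and the
`A`-integrals, where `s = -α ν - 1`; both have `n = ν - κ`. -/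
def momentIntegrand (α : ℝ) (n : ℕ) (s x : ℂ) : ℂ :=
  cosPow s x * Ftilde α x ^ n

/-- The boundary term of the recurrence: integrating its derivative relates the moments of
`(cos x) ^ s (F x) ^ n` for `s = p ± 1` to a moment with `n - 2`.  The truncation of `n - 1` is
harmless, since this term has the factor `n`. -/
def momentPrimitive (α : ℝ) (n : ℕ) (p x : ℂ) : ℂ :=
  Complex.sin x * momentIntegrand α n p x
    + n / (p + α) * momentIntegrand α (n - 1) (p + α) x

/-- The derivative of `momentPrimitive` in `x`; along an axis `x = ε t` it acquires the factor
`dx / dt = ε`.  The truncations of `n - 1` and `n - 2` are harmless, since this term has the factor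
`n (n - 1)`. -/
def momentPrimitiveDeriv (α : ℝ) (n : ℕ) (p x : ℂ) : ℂ :=
  (1 + p) * momentIntegrand α n (p + 1) x - p * momentIntegrand α n (p - 1) x
    + n * (n - 1 : ℕ) / (p + α) * momentIntegrand α (n - 2) (p + 2 * α - 1) x

section Axis

variable {α : ℝ} {ε : ℂ} {t : ℝ}

theorem Ftilde_axis (hε : ε = 1 ∨ ε = Complex.I) (t : ℝ) :
    Ftilde α (ε * t) = (∫ τ in (-(Real.pi / 2))..(0 : ℝ), cosPow (α - 1) τ)
      + ε * ∫ τ in (0 : ℝ)..t, cosPow (α - 1) (ε * τ) := by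
  rcases hε with rfl | rfl <;> simp [Ftilde]

theorem hasDerivAt_Ftilde_axis (hε : ε = 1 ∨ ε = Complex.I)
    (ht : |(ε * t).re| < Real.pi / 2) :
    HasDerivAt (fun τ : ℝ ↦ Ftilde α (ε * τ)) (ε * cosPow (α - 1) (ε * t)) t := by
  have hcont {τ : ℝ} (hτ : |(ε * τ).re| < Real.pi / 2) :
      ContinuousAt (fun τ : ℝ ↦ cosPow (α - 1) (ε * τ)) τ :=
    (hasDerivAt_cosPow _ hτ).continuousAt.comp (f := fun τ : ℝ ↦ ε * (τ : ℂ)) (by fun_prop)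
  have hopen : IsOpen {τ : ℝ | |(ε * τ).re| < Real.pi / 2} :=
    isOpen_lt (by fun_prop) continuous_const
  have hseg : ∀ τ ∈ uIcc 0 t, |(ε * τ).re| < Real.pi / 2 := by
    intro τ hτ
    refine lt_of_le_of_lt ?_ ht
    simp only [Complex.re_mul_ofReal, abs_mul]
    exact mul_le_mul_of_nonneg_left (by simpa using abs_sub_left_of_mem_uIcc hτ) (abs_nonneg _)
  have hint : HasDerivAt (fun τ ↦ ∫ τ in (0 : ℝ)..τ, cosPow (α - 1) (ε * τ))
      (cosPow (α - 1) (ε * t)) t := by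
    refine intervalIntegral.integral_hasDerivAt_right
      (ContinuousOn.intervalIntegrable fun τ hτ ↦ (hcont (hseg τ hτ)).continuousWithinAt) ?_
      (hcont ht)
    exact ContinuousOn.stronglyMeasurableAtFilter hopen
      (fun τ hτ ↦ (hcont hτ).continuousWithinAt) t ht
  simpa only [Ftilde_axis hε] using (hint.const_mul ε).const_add _

theorem hasDerivAt_momentIntegrand_axis (hε : ε = 1 ∨ ε = Complex.I) (n : ℕ) (s : ℂ)
    (ht : |(ε * t).re| < Real.pi / 2) :
    HasDerivAt (fun τ : ℝ ↦ momentIntegrand α n s (ε * τ))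
      (ε * (n * momentIntegrand α (n - 1) (s + α - 1) (ε * t)
        - s * Complex.sin (ε * t) * momentIntegrand α n (s - 1) (ε * t))) t := by
  have hline : HasDerivAt (fun τ : ℝ ↦ ε * (τ : ℂ)) ε t := by
    simpa using (Complex.ofRealCLM.hasDerivAt (x := t)).const_mul ε
  have hcos := (hasDerivAt_cosPow s ht).comp t hline
  refine (hcos.mul ((hasDerivAt_Ftilde_axis hε ht).pow n)).congr_deriv ?_
  simp only [momentIntegrand, add_sub_assoc, cosPow_add s, Function.comp_apply, Pi.pow_apply]
  ring

theorem cos_mul_momentIntegrand (n : ℕ) (s : ℂ) {x : ℂ} (hx : |x.re| < Real.pi / 2) :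
    Complex.cos x * momentIntegrand α n s x = momentIntegrand α n (s + 1) x := by
  rw [momentIntegrand, momentIntegrand, cosPow_add, cosPow_one hx]
  ring

theorem hasDerivAt_momentPrimitive_axis (hε : ε = 1 ∨ ε = Complex.I) (n : ℕ) {p : ℂ}
    (hp : n ≠ 0 → p + α ≠ 0) (ht : |(ε * t).re| < Real.pi / 2) :
    HasDerivAt (fun τ : ℝ ↦ momentPrimitive α n p (ε * τ))
      (ε * momentPrimitiveDeriv α n p (ε * t)) t := by
  have hline : HasDerivAt (fun τ : ℝ ↦ ε * (τ : ℂ)) ε t := by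
    simpa using (Complex.ofRealCLM.hasDerivAt (x := t)).const_mul ε
  have hsin := (Complex.hasDerivAt_sin (ε * t)).comp t hline
  refine ((hsin.mul (hasDerivAt_momentIntegrand_axis hε n p ht)).add
    ((hasDerivAt_momentIntegrand_axis hε (n - 1) (p + α) ht).const_mul
      (n / (p + α)))).congr_deriv ?_
  have hJ : momentIntegrand α n p (ε * t) =
      Complex.cos (ε * t) * momentIntegrand α n (p - 1) (ε * t) := by
    rw [cos_mul_momentIntegrand n _ ht, sub_add_cancel]
  have hJ' : momentIntegrand α n (p + 1) (ε * t) =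
      Complex.cos (ε * t) ^ 2 * momentIntegrand α n (p - 1) (ε * t) := by
    rw [← cos_mul_momentIntegrand n _ ht, hJ]
    ring
  have hcancel : n / (p + α) * (p + α) = n := by
    rcases eq_or_ne n 0 with rfl | hn
    · simp
    · exact div_mul_cancel₀ _ (hp hn)
  rw [momentPrimitiveDeriv, Function.comp_apply, Nat.sub_sub, hJ, hJ', add_assoc p α α,
    ← two_mul (α : ℂ)]
  linear_combination
    -ε * Complex.sin (ε * t) * momentIntegrand α (n - 1) (p + α - 1) (ε * t) * hcancel
    - ε * p * momentIntegrand α n (p - 1) (ε * t) * Complex.sin_sq_add_cos_sq (ε * t)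

end Axis

/-! ### Convergence of the moments -/

theorem continuousOn_momentIntegrand_axis {α : ℝ} {ε : ℂ} (hε : ε = 1 ∨ ε = Complex.I) (n : ℕ)
    (s : ℂ) : ContinuousOn (fun t : ℝ ↦ momentIntegrand α n s (ε * t))
      {t | |(ε * t).re| < Real.pi / 2} :=
  fun _ ht ↦ (hasDerivAt_momentIntegrand_axis hε n s ht).continuousAt.continuousWithinAt

theorem integrableOn_cos_rpow {σ : ℝ} (hσ : -1 < σ) :
    IntegrableOn (fun x : ℝ ↦ Real.cos x ^ σ) (Ioo (-(Real.pi / 2)) (Real.pi / 2)) := by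
  have hle : -(Real.pi / 2) ≤ Real.pi / 2 := by linarith [Real.pi_pos]
  set τ := min σ 0
  have hτ : -1 < τ := lt_min hσ (by norm_num)
  have hright : IntervalIntegrable (fun x : ℝ ↦ (1 - 2 / Real.pi * x) ^ τ) volume
      (-(Real.pi / 2)) (Real.pi / 2) := by
    have h := ((intervalIntegral.intervalIntegrable_rpow' (a := 0) (b := 2) hτ).comp_sub_left
      1).comp_mul_left (c := 2 / Real.pi)
    convert h.symm using 1 <;> field_simp <;> norm_num
  have hleft : IntervalIntegrable (fun x : ℝ ↦ (1 + 2 / Real.pi * x) ^ τ) volume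
      (-(Real.pi / 2)) (Real.pi / 2) := by
    have h := ((intervalIntegral.intervalIntegrable_rpow' (a := 0) (b := 2) hτ).comp_add_left
      1).comp_mul_left (c := 2 / Real.pi)
    convert h using 1 <;> field_simp <;> norm_num
  refine ((intervalIntegrable_iff_integrableOn_Ioo_of_le hle).1 (hleft.add hright)).mono'
    (Real.measurable_cos.pow_const σ).aestronglyMeasurable
    ((ae_restrict_iff' measurableSet_Ioo).2 (Eventually.of_forall fun x hx ↦ ?_))
  have hlt : |2 / Real.pi * x| < 1 := by
    rw [abs_mul, abs_of_pos (by positivity), div_mul_eq_mul_div, div_lt_one Real.pi_pos]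
    linarith [abs_lt.2 hx]
  have hpos_left : 0 < 1 + 2 / Real.pi * x := by linarith [(abs_lt.1 hlt).1]
  have hpos_right : 0 < 1 - 2 / Real.pi * x := by linarith [(abs_lt.1 hlt).2]
  rw [Real.norm_of_nonneg (Real.rpow_nonneg (Real.cos_pos_of_mem_Ioo hx).le _)]
  refine (Real.rpow_le_rpow_of_exponent_ge (Real.cos_pos_of_mem_Ioo hx) (Real.cos_le_one x)
    (min_le_left σ 0)).trans ?_
  rcases le_total 0 x with h | h
  · exact (Real.rpow_le_rpow_of_nonpos hpos_right (Real.one_sub_mul_le_cos h hx.2.le)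
      (min_le_right _ _)).trans (le_add_of_nonneg_left (Real.rpow_nonneg hpos_left.le _))
  · exact (Real.rpow_le_rpow_of_nonpos hpos_left (Real.one_add_mul_le_cos hx.1.le h)
      (min_le_right _ _)).trans (le_add_of_nonneg_right (Real.rpow_nonneg hpos_right.le _))

theorem exists_norm_Ftilde_ofReal_le {α : ℝ} (hα : 0 < α) :
    ∃ M : ℝ, ∀ x ∈ Ioo (-(Real.pi / 2)) (Real.pi / 2), ‖Ftilde α (x : ℝ)‖ ≤ M := by
  refine ⟨‖∫ τ in (-(Real.pi / 2))..(0 : ℝ), cosPow (α - 1) τ‖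
    + ∫ τ in Ioo (-(Real.pi / 2)) (Real.pi / 2), Real.cos τ ^ (α - 1), fun x hx ↦ ?_⟩
  have hsub : uIoc 0 x ⊆ Ioo (-(Real.pi / 2)) (Real.pi / 2) :=
    uIoc_subset_uIcc.trans (ordConnected_Ioo.uIcc_subset
      ⟨by linarith [Real.pi_pos], by linarith [Real.pi_pos]⟩ hx)
  have hF := Ftilde_axis (α := α) (Or.inl rfl) x
  simp only [one_mul] at hF
  rw [hF]
  refine (norm_add_le _ _).trans (add_le_add_right ?_ _)
  calc ‖∫ τ in (0 : ℝ)..x, cosPow (α - 1) τ‖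
      ≤ ∫ τ in uIoc 0 x, ‖cosPow (α - 1) (τ : ℝ)‖ :=
        intervalIntegral.norm_integral_le_integral_norm_uIoc
    _ = ∫ τ in uIoc 0 x, Real.cos τ ^ (α - 1) :=
        setIntegral_congr_fun measurableSet_uIoc fun τ hτ ↦ by
          simpa using norm_cosPow_ofReal (α - 1) (abs_lt.2 (hsub hτ))
    _ ≤ _ := setIntegral_mono_set (integrableOn_cos_rpow (by linarith))
        ((ae_restrict_iff' measurableSet_Ioo).2 (Eventually.of_forall fun τ hτ ↦
          Real.rpow_nonneg (Real.cos_pos_of_mem_Ioo hτ).le _)) hsub.eventuallyLE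

theorem exists_norm_momentIntegrand_ofReal_le {α : ℝ} (hα : 0 < α) (n : ℕ) (s : ℂ) :
    ∃ C : ℝ, ∀ x ∈ Ioo (-(Real.pi / 2)) (Real.pi / 2),
      ‖momentIntegrand α n s (x : ℝ)‖ ≤ C * Real.cos x ^ s.re := by
  obtain ⟨M, hM⟩ := exists_norm_Ftilde_ofReal_le hα
  refine ⟨M ^ n, fun x hx ↦ ?_⟩
  rw [momentIntegrand, norm_mul, norm_pow, norm_cosPow_ofReal s (abs_lt.2 hx), mul_comm]
  have := Real.cos_pos_of_mem_Ioo hx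
  gcongr
  exact hM x hx

theorem integrableOn_momentIntegrand_ofReal {α : ℝ} (hα : 0 < α) (n : ℕ) {s : ℂ}
    (hs : -1 < s.re) :
    IntegrableOn (fun x : ℝ ↦ momentIntegrand α n s x) (Ioo (-(Real.pi / 2)) (Real.pi / 2)) := by
  obtain ⟨C, hC⟩ := exists_norm_momentIntegrand_ofReal_le hα n s
  have hcont : ContinuousOn (fun x : ℝ ↦ momentIntegrand α n s x)
      (Ioo (-(Real.pi / 2)) (Real.pi / 2)) :=
    (continuousOn_momentIntegrand_axis (α := α) (Or.inl rfl) n s).congr_mono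
      (fun x _ ↦ by simp only [one_mul]) fun x hx ↦ by simpa [abs_lt] using hx
  exact ((integrableOn_cos_rpow hs).const_mul C).mono'
    (hcont.aestronglyMeasurable measurableSet_Ioo)
    ((ae_restrict_iff' measurableSet_Ioo).2 (Eventually.of_forall hC))

theorem tendsto_momentIntegrand_of_cos_eq_zero {α : ℝ} (hα : 0 < α) (n : ℕ) {s : ℂ}
    (hs : 0 < s.re) {a : ℝ} (ha : Real.cos a = 0) {l : Filter ℝ} (hla : l ≤ 𝓝 a)
    (hl : Ioo (-(Real.pi / 2)) (Real.pi / 2) ∈ l) :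
    Tendsto (fun x : ℝ ↦ momentIntegrand α n s x) l (𝓝 0) := by
  obtain ⟨C, hC⟩ := exists_norm_momentIntegrand_ofReal_le hα n s
  refine squeeze_zero_norm' (eventually_of_mem hl hC) ?_
  have hcos : Tendsto (fun x ↦ C * Real.cos x ^ s.re) (𝓝 a) (𝓝 (C * Real.cos a ^ s.re)) :=
    (Real.continuous_cos.continuousAt.rpow_const (Or.inr hs.le)).const_mul C
  rw [ha, Real.zero_rpow hs.ne', mul_zero] at hcos
  exact hcos.mono_left hla

theorem tendsto_momentPrimitive_of_cos_eq_zero {α : ℝ} (hα : 0 < α) (n : ℕ) {p : ℂ}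
    (hp : 0 < p.re) {a : ℝ} (ha : Real.cos a = 0) {l : Filter ℝ} (hla : l ≤ 𝓝 a)
    (hl : Ioo (-(Real.pi / 2)) (Real.pi / 2) ∈ l) :
    Tendsto (fun x : ℝ ↦ momentPrimitive α n p x) l (𝓝 0) := by
  have hsin : Tendsto (fun x : ℝ ↦ Complex.sin x) l (𝓝 (Complex.sin a)) :=
    (Complex.continuous_sin.comp Complex.continuous_ofReal).continuousAt.mono_left hla
  have hfst := hsin.mul (tendsto_momentIntegrand_of_cos_eq_zero hα n hp ha hla hl)
  have hsnd := (tendsto_momentIntegrand_of_cos_eq_zero hα (n - 1) (s := p + α)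
    (by simpa using add_pos hp hα) ha hla hl).const_mul (n / (p + α))
  simpa only [momentPrimitive, mul_zero, add_zero] using hfst.add hsnd

theorem exp_abs_le_two_mul_cosh (y : ℝ) : Real.exp |y| ≤ 2 * Real.cosh y := by
  rw [Real.cosh_eq]
  linarith [Real.exp_abs_le y]

theorem cosh_le_exp_abs (y : ℝ) : Real.cosh y ≤ Real.exp |y| := by
  rw [← Real.cosh_abs, ← Real.cosh_add_sinh]
  exact le_add_of_nonneg_right (Real.sinh_nonneg_iff.2 (abs_nonneg y))

theorem abs_sinh_le_cosh (y : ℝ) : |Real.sinh y| ≤ Real.cosh y := by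
  rw [Real.abs_sinh, ← Real.cosh_abs]
  exact (Real.sinh_lt_cosh (x := |y|)).le

theorem cosh_mul_le_rpow {σ : ℝ} (hσ : 0 ≤ σ) (y : ℝ) :
    Real.cosh (σ * y) ≤ (2 * Real.cosh y) ^ σ :=
  calc Real.cosh (σ * y) ≤ Real.exp |σ * y| := cosh_le_exp_abs _
    _ = Real.exp |y| ^ σ := by rw [abs_mul, abs_of_nonneg hσ, ← Real.exp_mul, mul_comm]
    _ ≤ (2 * Real.cosh y) ^ σ :=
      Real.rpow_le_rpow (Real.exp_pos _).le (exp_abs_le_two_mul_cosh y) hσ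

theorem cosh_rpow_le_two_mul_cosh_mul {σ : ℝ} (hσ : 0 ≤ σ) (y : ℝ) :
    Real.cosh y ^ σ ≤ 2 * Real.cosh (σ * y) :=
  calc Real.cosh y ^ σ ≤ Real.exp |y| ^ σ :=
      Real.rpow_le_rpow (Real.cosh_pos y).le (cosh_le_exp_abs y) hσ
    _ = Real.exp |σ * y| := by rw [abs_mul, abs_of_nonneg hσ, ← Real.exp_mul, mul_comm]
    _ ≤ 2 * Real.cosh (σ * y) := exp_abs_le_two_mul_cosh _

theorem integrable_exp_mul_abs {σ : ℝ} (hσ : σ < 0) :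
    Integrable fun y : ℝ ↦ Real.exp (σ * |y|) := by
  rw [← integrableOn_univ, ← Iic_union_Ioi (a := (0 : ℝ))]
  refine ((integrableOn_exp_mul_Iic (neg_pos.2 hσ) 0).congr_fun (fun y hy ↦ ?_)
    measurableSet_Iic).union ((integrableOn_exp_mul_Ioi hσ 0).congr_fun (fun y hy ↦ ?_)
      measurableSet_Ioi)
  · simp only [abs_of_nonpos (mem_Iic.1 hy), mul_neg, neg_mul]
  · simp only [abs_of_pos (mem_Ioi.1 hy)]

theorem integrable_cosh_rpow {σ : ℝ} (hσ : σ < 0) : Integrable fun y : ℝ ↦ Real.cosh y ^ σ := by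
  have hcont : Continuous fun y : ℝ ↦ Real.cosh y ^ σ :=
    Real.continuous_cosh.rpow_const fun y ↦ Or.inl (Real.cosh_pos y).ne'
  refine ((integrable_exp_mul_abs hσ).const_mul ((1 / 2) ^ σ)).mono' hcont.aestronglyMeasurable
    (Eventually.of_forall fun y ↦ ?_)
  rw [Real.norm_of_nonneg (Real.rpow_nonneg (Real.cosh_pos y).le σ), mul_comm σ, Real.exp_mul,
    ← Real.mul_rpow (by norm_num) (Real.exp_pos _).le]
  exact Real.rpow_le_rpow_of_nonpos (by positivity)
    (by linarith [exp_abs_le_two_mul_cosh y]) hσ.le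

theorem norm_integral_cosPow_I_mul_le {α : ℝ} (hα : 0 < α) (y : ℝ) :
    ‖∫ τ in (0 : ℝ)..y, cosPow (α - 1) (Complex.I * τ)‖ ≤ 2 / α * (2 * Real.cosh y) ^ α := by
  have hbound (τ : ℝ) : ‖cosPow (α - 1) (Complex.I * τ)‖ ≤ 2 * Real.cosh (α * τ) :=
    calc ‖cosPow (α - 1) (Complex.I * τ)‖ = Real.cosh τ ^ (α - 1) := by
          simpa using norm_cosPow_I_mul (α - 1) τ
      _ ≤ Real.cosh τ ^ α :=
          Real.rpow_le_rpow_of_exponent_le (Real.one_le_cosh τ) (by linarith)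
      _ ≤ 2 * Real.cosh (α * τ) := cosh_rpow_le_two_mul_cosh_mul hα.le τ
  have hderiv (τ : ℝ) : HasDerivAt (fun τ ↦ 2 / α * Real.sinh (α * τ)) (2 * Real.cosh (α * τ)) τ :=
    (((hasDerivAt_id τ).const_mul α).sinh.const_mul (2 / α)).congr_deriv (by simp; field_simp)
  have hint : IntervalIntegrable (fun τ ↦ 2 * Real.cosh (α * τ)) volume 0 y :=
    Continuous.intervalIntegrable (by fun_prop) _ _
  calc ‖∫ τ in (0 : ℝ)..y, cosPow (α - 1) (Complex.I * τ)‖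
      ≤ |∫ τ in (0 : ℝ)..y, 2 * Real.cosh (α * τ)| :=
        intervalIntegral.norm_integral_le_abs_of_norm_le (Eventually.of_forall hbound) hint
    _ = 2 / α * |Real.sinh (α * y)| := by
        rw [intervalIntegral.integral_eq_sub_of_hasDerivAt (fun τ _ ↦ hderiv τ) hint, mul_zero,
          Real.sinh_zero, mul_zero, sub_zero, abs_mul, abs_of_pos (by positivity)]
    _ ≤ 2 / α * (2 * Real.cosh y) ^ α :=
        mul_le_mul_of_nonneg_left
          ((abs_sinh_le_cosh _).trans (cosh_mul_le_rpow hα.le y)) (by positivity)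

theorem exists_norm_Ftilde_I_mul_le {α : ℝ} (hα : 0 < α) :
    ∃ M : ℝ, ∀ y : ℝ, ‖Ftilde α (Complex.I * y)‖ ≤ M * Real.cosh y ^ α := by
  refine ⟨‖∫ τ in (-(Real.pi / 2))..(0 : ℝ), cosPow (α - 1) τ‖ + 2 / α * 2 ^ α, fun y ↦ ?_⟩
  rw [Ftilde_axis (Or.inr rfl), add_mul, mul_assoc,
    ← Real.mul_rpow zero_le_two (Real.cosh_pos y).le]
  refine (norm_add_le _ _).trans (add_le_add ?_ ?_)
  · exact le_mul_of_one_le_right (norm_nonneg _)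
      (Real.one_le_rpow (Real.one_le_cosh y) hα.le)
  · rw [norm_mul, Complex.norm_I, one_mul]
    exact norm_integral_cosPow_I_mul_le hα y

theorem continuous_momentIntegrand_I_mul (α : ℝ) (n : ℕ) (s : ℂ) :
    Continuous fun y : ℝ ↦ momentIntegrand α n s (Complex.I * y) := by
  rw [← continuousOn_univ]
  exact (continuousOn_momentIntegrand_axis (Or.inr rfl) n s).mono fun y _ ↦ by
    simpa using Real.pi_pos

theorem integrable_momentIntegrand_I_mul {α : ℝ} (hα : 0 < α) (n : ℕ) {s : ℂ}
    (hs : s.re + α * n < 0) :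
    Integrable fun y : ℝ ↦ momentIntegrand α n s (Complex.I * y) := by
  obtain ⟨M, hM⟩ := exists_norm_Ftilde_I_mul_le hα
  refine ((integrable_cosh_rpow hs).const_mul (M ^ n)).mono'
    (continuous_momentIntegrand_I_mul α n s).aestronglyMeasurable
    (Eventually.of_forall fun y ↦ ?_)
  rw [momentIntegrand, norm_mul, norm_pow, norm_cosPow_I_mul]
  have hcosh := Real.cosh_pos y
  calc Real.cosh y ^ s.re * ‖Ftilde α (Complex.I * y)‖ ^ n
      ≤ Real.cosh y ^ s.re * (M * Real.cosh y ^ α) ^ n := by gcongr; exact hM y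
    _ = M ^ n * Real.cosh y ^ (s.re + α * n) := by
      rw [mul_pow, Real.rpow_add hcosh, Real.rpow_mul hcosh.le, Real.rpow_natCast]
      ring

/-! ### The recurrence of the moments -/

/-- The moment `∫ (cos x) ^ s (F x) ^ n dx` over the part `x = ε t`, `t ∈ S`, of the real axis
(`ε = 1`) or of the imaginary axis (`ε = i`), with the factor `α ^ n / n!` of the `B`-integrals and
without the factor `dx / dt = ε`. -/
def moment (α : ℝ) (ε : ℂ) (S : Set ℝ) (n : ℕ) (s : ℂ) : ℂ :=
  α ^ n / n.factorial * ∫ t in S, momentIntegrand α n s (ε * t)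

/-- The relation between `M n (p + 1)`, `M n (p - 1)` and `M (n - 2) (p + 2 α - 1)` that the moments
inherit from `momentPrimitive`. -/
def MomentRecurrence (α : ℝ) (M : ℕ → ℂ → ℂ) (n : ℕ) (p : ℂ) : Prop :=
  (1 + p) * M n (p + 1) - p * M n (p - 1)
    + (if 2 ≤ n then α ^ 2 / (p + α) * M (n - 2) (p + 2 * α - 1) else 0) = 0

theorem pow_div_factorial_mul {𝕜 : Type*} [Field 𝕜] [CharZero 𝕜] (a : 𝕜) {n : ℕ} (hn : 2 ≤ n) :
    a ^ n / n.factorial * (n * (n - 1 : ℕ)) = a ^ 2 * (a ^ (n - 2) / (n - 2).factorial) := by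
  obtain ⟨m, rfl⟩ := Nat.exists_eq_add_of_le' hn
  have hfact : ((m + 2).factorial : 𝕜) = (m + 2 : ℕ) * ((m + 1 : ℕ) * m.factorial) := by
    exact_mod_cast (rfl : (m + 2).factorial = _)
  have : ((m + 2 : ℕ) : 𝕜) ≠ 0 := Nat.cast_ne_zero.2 (by omega)
  have : ((m + 1 : ℕ) : 𝕜) ≠ 0 := Nat.cast_ne_zero.2 (by omega)
  have : (m.factorial : 𝕜) ≠ 0 := Nat.cast_ne_zero.2 m.factorial_ne_zero
  rw [hfact, show m + 2 - 1 = m + 1 by omega, Nat.add_sub_cancel, pow_add]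
  field_simp

section Moment

variable {α : ℝ} {ε : ℂ} {S : Set ℝ} {n : ℕ} {p : ℂ}

theorem integrableOn_coeff_mul_momentIntegrand_sub_two
    (h₃ : 2 ≤ n → IntegrableOn (fun t : ℝ ↦ momentIntegrand α (n - 2) (p + 2 * α - 1) (ε * t)) S) :
    IntegrableOn (fun t : ℝ ↦ n * (n - 1 : ℕ) / (p + α)
      * momentIntegrand α (n - 2) (p + 2 * α - 1) (ε * t)) S := by
  rcases lt_or_ge n 2 with hn | hn
  · interval_cases n <;> simp
  · exact (h₃ hn).const_mul _

theorem integrableOn_momentPrimitiveDeriv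
    (h₁ : IntegrableOn (fun t : ℝ ↦ momentIntegrand α n (p + 1) (ε * t)) S)
    (h₂ : IntegrableOn (fun t : ℝ ↦ momentIntegrand α n (p - 1) (ε * t)) S)
    (h₃ : 2 ≤ n → IntegrableOn (fun t : ℝ ↦ momentIntegrand α (n - 2) (p + 2 * α - 1) (ε * t)) S) :
    IntegrableOn (fun t : ℝ ↦ momentPrimitiveDeriv α n p (ε * t)) S :=
  ((h₁.const_mul _).sub (h₂.const_mul _)).add (integrableOn_coeff_mul_momentIntegrand_sub_two h₃)

theorem momentRecurrence_moment
    (h₁ : IntegrableOn (fun t : ℝ ↦ momentIntegrand α n (p + 1) (ε * t)) S)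
    (h₂ : IntegrableOn (fun t : ℝ ↦ momentIntegrand α n (p - 1) (ε * t)) S)
    (h₃ : 2 ≤ n → IntegrableOn (fun t : ℝ ↦ momentIntegrand α (n - 2) (p + 2 * α - 1) (ε * t)) S)
    (h₀ : ∫ t in S, momentPrimitiveDeriv α n p (ε * (t : ℝ)) = 0) :
    MomentRecurrence α (moment α ε S) n p := by
  have hsub : IntegrableOn (fun t : ℝ ↦ (1 + p) * momentIntegrand α n (p + 1) (ε * t)
      - p * momentIntegrand α n (p - 1) (ε * t)) S := (h₁.const_mul _).sub (h₂.const_mul _)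
  simp only [momentPrimitiveDeriv] at h₀
  rw [integral_add hsub (integrableOn_coeff_mul_momentIntegrand_sub_two h₃),
    integral_sub (h₁.const_mul _) (h₂.const_mul _), integral_const_mul, integral_const_mul,
    integral_const_mul] at h₀
  rw [MomentRecurrence]
  split_ifs with hn
  · simp only [moment]
    linear_combination (α : ℂ) ^ n / n.factorial * h₀
      - (∫ t in S, momentIntegrand α (n - 2) (p + 2 * α - 1) (ε * (t : ℝ))) / (p + α)
        * pow_div_factorial_mul (α : ℂ) hn
  · have hcoeff : (n * (n - 1 : ℕ) : ℂ) = 0 := by interval_cases n <;> simp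
    simp only [moment]
    linear_combination (α : ℂ) ^ n / n.factorial * h₀ - (α : ℂ) ^ n / n.factorial
      * (∫ t in S, momentIntegrand α (n - 2) (p + 2 * α - 1) (ε * (t : ℝ))) / (p + α) * hcoeff

theorem differentiableOn_moment {I : Set ℝ} (hI : IsOpen I) (hS : MeasurableSet S) {c : ℝ → ℝ}
    (hc : Measurable c) (hpos : ∀ t ∈ S, 0 < c t)
    (hcos : ∀ s : ℂ, ∀ t ∈ S, cosPow s (ε * t) = (c t : ℂ) ^ s)
    (hint : ∀ s : ℂ, s.re ∈ I → IntegrableOn (fun t : ℝ ↦ momentIntegrand α n s (ε * t)) S) :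
    DifferentiableOn ℂ (moment α ε S n) {s | s.re ∈ I} := by
  have hcongr (s : ℂ) : EqOn (fun t : ℝ ↦ momentIntegrand α n s (ε * t))
      (fun t : ℝ ↦ (c t : ℂ) ^ s * Ftilde α (ε * t) ^ n) S := fun t ht ↦ by
    simp only [momentIntegrand, hcos s t ht]
  refine ((differentiableOn_integral_cpow_mul (μ := volume.restrict S) hI hc.aemeasurable
    ((ae_restrict_iff' hS).2 (Eventually.of_forall hpos)) fun s hs ↦
      (hint s hs).congr_fun (hcongr s) hS).const_mul (α ^ n / n.factorial)).congr fun s _ ↦ ?_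
  rw [moment, setIntegral_congr_fun hS (hcongr s)]

end Moment

/-- The moments over the interval `(-π/2, π/2)`. -/
abbrev realMoment (α : ℝ) : ℕ → ℂ → ℂ :=
  moment α 1 (Ioo (-(Real.pi / 2)) (Real.pi / 2))

/-- The moments over the imaginary axis. -/
abbrev imagMoment (α : ℝ) : ℕ → ℂ → ℂ :=
  moment α Complex.I univ

section RealImag

variable {α : ℝ}

theorem differentiableOn_realMoment (hα : 0 < α) (n : ℕ) :
    DifferentiableOn ℂ (realMoment α n) {s | s.re ∈ Ioi (-1)} :=
  differentiableOn_moment isOpen_Ioi measurableSet_Ioo Real.measurable_cos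
    (fun _ ht ↦ Real.cos_pos_of_mem_Ioo ht)
    (fun s _ ht ↦ by rw [one_mul, cosPow_ofReal s (abs_lt.2 ht)])
    fun s hs ↦ by simpa only [one_mul] using integrableOn_momentIntegrand_ofReal hα n hs

theorem differentiableOn_imagMoment (hα : 0 < α) (n : ℕ) :
    DifferentiableOn ℂ (imagMoment α n) {s | s.re ∈ Iio (-(α * n))} :=
  differentiableOn_moment isOpen_Iio MeasurableSet.univ Real.measurable_cosh
    (fun t _ ↦ Real.cosh_pos t) (fun s t _ ↦ cosPow_I_mul s t)
    fun s hs ↦ (integrable_momentIntegrand_I_mul hα n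
      (by linarith [mem_Iio.1 hs])).integrableOn

theorem momentRecurrence_realMoment (hα : 0 < α) (n : ℕ) {p : ℂ} (hp : 0 < p.re) :
    MomentRecurrence α (realMoment α) n p := by
  have hle : -(Real.pi / 2) < Real.pi / 2 := by linarith [Real.pi_pos]
  have hpα : p + α ≠ 0 := fun h ↦ by
    have hre := congrArg Complex.re h
    simp only [Complex.add_re, Complex.ofReal_re, Complex.zero_re] at hre
    linarith
  have hint (m : ℕ) {s : ℂ} (hs : -1 < s.re) : IntegrableOn
      (fun t : ℝ ↦ momentIntegrand α m s (1 * t)) (Ioo (-(Real.pi / 2)) (Real.pi / 2)) := by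
    simpa only [one_mul] using integrableOn_momentIntegrand_ofReal hα m hs
  have h₁ := hint n (s := p + 1) (by rw [Complex.add_re, Complex.one_re]; linarith)
  have h₂ := hint n (s := p - 1) (by simpa using hp)
  have h₃ := hint (n - 2) (s := p + 2 * α - 1) (by
    simp only [Complex.sub_re, Complex.add_re, Complex.re_mul_ofReal, Complex.re_ofNat,
      Complex.one_re]
    linarith)
  refine momentRecurrence_moment h₁ h₂ (fun _ ↦ h₃) ?_
  have hW {a : ℝ} {l : Filter ℝ} (ha : Real.cos a = 0) (hla : l ≤ 𝓝 a)
      (hl : Ioo (-(Real.pi / 2)) (Real.pi / 2) ∈ l) :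
      Tendsto (fun x : ℝ ↦ momentPrimitive α n p (1 * x)) l (𝓝 0) := by
    simpa only [one_mul] using tendsto_momentPrimitive_of_cos_eq_zero hα n hp ha hla hl
  have hFTC := intervalIntegral.integral_eq_sub_of_hasDerivAt_of_tendsto hle
    (fun x hx ↦ hasDerivAt_momentPrimitive_axis (Or.inl rfl) n (fun _ ↦ hpα)
      (by simpa [abs_lt] using hx))
    ((intervalIntegrable_iff_integrableOn_Ioo_of_le hle.le).2
      ((integrableOn_momentPrimitiveDeriv h₁ h₂ fun _ ↦ h₃).const_mul 1))
    (hW (by simp) nhdsWithin_le_nhds (Ioo_mem_nhdsGT hle))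
    (hW (by simp) nhdsWithin_le_nhds (Ioo_mem_nhdsLT hle))
  rw [intervalIntegral.integral_of_le hle.le, integral_Ioc_eq_integral_Ioo, sub_zero] at hFTC
  simpa only [one_mul] using hFTC

theorem integrable_momentPrimitive_I_mul (hα : 0 < α) (n : ℕ) {p : ℂ}
    (hp : p.re + 1 + α * n < 0) :
    Integrable fun y : ℝ ↦ momentPrimitive α n p (Complex.I * y) := by
  have hfst : Integrable fun y : ℝ ↦
      Complex.sin (Complex.I * y) * momentIntegrand α n p (Complex.I * y) := by
    refine (integrable_momentIntegrand_I_mul hα n (s := p + 1) (by simpa using hp)).mono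
      (Continuous.aestronglyMeasurable (.mul (by fun_prop)
        (continuous_momentIntegrand_I_mul α n p))) (Eventually.of_forall fun y ↦ ?_)
    rw [← cos_mul_momentIntegrand n p (by simpa using Real.pi_pos), norm_mul, norm_mul,
      mul_comm Complex.I, Complex.sin_mul_I, Complex.cos_mul_I, norm_mul, Complex.norm_I, mul_one,
      ← Complex.ofReal_sinh, ← Complex.ofReal_cosh, Complex.norm_real, Complex.norm_real]
    refine mul_le_mul_of_nonneg_right ?_ (norm_nonneg _)
    rw [Real.norm_eq_abs, Real.norm_of_nonneg (Real.cosh_pos y).le]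
    exact abs_sinh_le_cosh y
  refine hfst.add ?_
  rcases n with _ | n
  · simp
  · refine (integrable_momentIntegrand_I_mul hα n (s := p + α) ?_).const_mul _
    push_cast at hp
    simp only [Complex.add_re, Complex.ofReal_re]
    linarith

theorem momentRecurrence_imagMoment (hα : 0 < α) (n : ℕ) {p : ℂ} (hp : p.re + 1 + α * n < 0) :
    MomentRecurrence α (imagMoment α) n p := by
  have hpα (hn : n ≠ 0) : p + α ≠ 0 := fun h ↦ by
    have hre := congrArg Complex.re h
    simp only [Complex.add_re, Complex.ofReal_re, Complex.zero_re] at hre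
    have : (1 : ℝ) ≤ n := by exact_mod_cast Nat.one_le_iff_ne_zero.2 hn
    nlinarith
  have hint (m : ℕ) {s : ℂ} (hs : s.re + α * m < 0) : IntegrableOn
      (fun y : ℝ ↦ momentIntegrand α m s (Complex.I * y)) univ :=
    (integrable_momentIntegrand_I_mul hα m hs).integrableOn
  have h₁ := hint n (s := p + 1) (by simpa using hp)
  have h₂ := hint n (s := p - 1) (by rw [Complex.sub_re, Complex.one_re]; linarith)
  have h₃ (hn : 2 ≤ n) := hint (n - 2) (s := p + 2 * α - 1) (by
    simp only [Complex.sub_re, Complex.add_re, Complex.re_mul_ofReal, Complex.re_ofNat,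
      Complex.one_re, Nat.cast_sub hn, Nat.cast_ofNat]
    linarith)
  refine momentRecurrence_moment h₁ h₂ h₃ ?_
  have hint' := integrableOn_univ.1 (integrableOn_momentPrimitiveDeriv h₁ h₂ h₃)
  have hFTC := integral_eq_zero_of_hasDerivAt_of_integrable
    (fun y ↦ hasDerivAt_momentPrimitive_axis (Or.inr rfl) n hpα (by simpa using Real.pi_pos))
    (hint'.const_mul Complex.I) (integrable_momentPrimitive_I_mul hα n hp)
  rw [integral_const_mul] at hFTC
  simpa using hFTC

/-! ### Meromorphic continuation of the moments -/

theorem exists_meromorphic_eqOn_realMoment (hα : 0 < α) (n : ℕ) :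
    ∃ g, Meromorphic g ∧ EqOn g (realMoment α n) {s | s.re ∈ Ioi (-1)} := by
  have hopen : IsOpen {s : ℂ | s.re ∈ Ioi (-1)} := isOpen_Ioi.preimage Complex.continuous_re
  refine exists_meromorphic_eqOn_of_recurrence two_pos
    (U := fun _ ↦ {s : ℂ | s.re ∈ Ioi (-1)})
    (δ := 2) (c := 2 * α) (r := fun z ↦ (z + 2) / (z + 1))
    (q := fun z ↦ α ^ 2 / ((z + 1) * (z + 1 + α)))
    (fun _ ↦ hopen) (fun _ z hz ↦ ?_) (fun _ z ↦ ?_)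
    (fun n ↦ ((differentiableOn_realMoment hα n).analyticOnNhd hopen).meromorphicOn)
    (fun x ↦ by fun_prop) (fun x ↦ by fun_prop) (fun n _ z hz ↦ ?_) (fun n z hz ↦ ?_) n
  · simp only [mem_ofPred_eq, mem_Ioi, Complex.add_re, Complex.re_ofNat] at hz ⊢
    linarith
  · obtain ⟨m, hm⟩ := exists_nat_gt (-z.re)
    refine ⟨m, ?_⟩
    simp only [mem_ofPred_eq, mem_Ioi, Complex.add_re, Complex.mul_re, Complex.natCast_re,
      Complex.re_ofNat, Complex.natCast_im, zero_mul, sub_zero]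
    linarith [m.cast_nonneg (α := ℝ)]
  · have : (z + 2 * α).re = z.re + 2 * α := by simp
    simp only [mem_ofPred_eq, mem_Ioi, this] at hz ⊢
    linarith
  · have hp : 0 < (z + 1).re := by
      simp only [mem_ofPred_eq, mem_Ioi] at hz
      simpa using by linarith
    have hz₁ : z + 1 ≠ 0 := fun h ↦ by simp [h] at hp
    have hrec := momentRecurrence_realMoment hα n hp
    rw [MomentRecurrence, add_sub_cancel_right, add_assoc z, one_add_one_eq_two,
      show z + 1 + 2 * (α : ℂ) - 1 = z + 2 * α by ring] at hrec
    refine mul_left_cancel₀ hz₁ ?_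
    split_ifs at hrec ⊢ <;> field_simp <;> linear_combination -hrec

theorem exists_meromorphic_eqOn_imagMoment (hα : 0 < α) (n : ℕ) :
    ∃ g, Meromorphic g ∧ EqOn g (imagMoment α n) {s | s.re ∈ Iio (-(α * n))} := by
  have hopen (n : ℕ) : IsOpen {s : ℂ | s.re ∈ Iio (-(α * n))} :=
    isOpen_Iio.preimage Complex.continuous_re
  refine exists_meromorphic_eqOn_of_recurrence two_pos
    (U := fun n ↦ {s : ℂ | s.re ∈ Iio (-(α * n))})
    (δ := -2) (c := 2 * (α - 1)) (r := fun z ↦ (z - 1) / z)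
    (q := fun z ↦ -(α ^ 2 / (z * (z - 1 + α))))
    hopen (fun n z hz ↦ ?_) (fun n z ↦ ?_)
    (fun n ↦ ((differentiableOn_imagMoment hα n).analyticOnNhd (hopen n)).meromorphicOn)
    (fun x ↦ by fun_prop) (fun x ↦ by fun_prop) (fun n hn z hz ↦ ?_) (fun n z hz ↦ ?_) n
  · simp only [mem_ofPred_eq, mem_Iio, Complex.add_re, Complex.neg_re, Complex.re_ofNat] at hz ⊢
    linarith
  · obtain ⟨m, hm⟩ := exists_nat_gt (z.re + α * n)
    refine ⟨m, ?_⟩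
    simp only [mem_ofPred_eq, mem_Iio, Complex.add_re, Complex.mul_re, Complex.natCast_re,
      Complex.neg_re, Complex.re_ofNat, Complex.natCast_im, zero_mul, sub_zero]
    linarith [m.cast_nonneg (α := ℝ)]
  · have : (z + 2 * (α - 1)).re = z.re + 2 * (α - 1) := by simp
    simp only [mem_ofPred_eq, mem_Iio, this, Nat.cast_sub hn] at hz ⊢
    push_cast
    linarith
  · simp only [mem_ofPred_eq, mem_Iio] at hz
    have hz₀ : z ≠ 0 := fun h ↦ by
      rw [h, Complex.zero_re] at hz
      linarith [mul_nonneg hα.le n.cast_nonneg]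
    have hrec := momentRecurrence_imagMoment hα n (p := z - 1) (by
      simp only [Complex.sub_re, Complex.one_re]
      linarith)
    rw [MomentRecurrence, sub_add_cancel, add_sub_cancel, sub_sub, one_add_one_eq_two,
      show z - 1 + 2 * (α : ℂ) - 1 = z + 2 * (α - 1) by ring, sub_eq_add_neg z 2] at hrec
    refine mul_left_cancel₀ hz₀ ?_
    split_ifs at hrec ⊢ <;> field_simp <;> linear_combination hrec

end RealImag

/-! ### The quantities `B` and `A` -/

section BA

variable {α : ℝ}

theorem integralB_eq_realMoment (N : ℕ) (κ : ℂ) :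
    integralB α N κ = (Complex.Gamma κ)⁻¹ * realMoment α N (α * κ - 1) := by
  rw [integralB, intervalIntegral.integral_of_le (by linarith [Real.pi_pos]),
    integral_Ioc_eq_integral_Ioo, realMoment, moment]
  simp only [integrandB, momentIntegrand, one_mul]
  ring

theorem integralA_eq_imagMoment (N : ℕ) (κ : ℂ) :
    integralA α N κ = Complex.Gamma (κ + N + 1)
      * (α / (2 * Real.pi) * imagMoment α N (-α * (κ + N) - 1)) := by
  rw [integralA, imagMoment, moment, Measure.restrict_univ]
  simp only [integrandA, momentIntegrand]
  have := Complex.I_ne_zero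
  field_simp
  ring

theorem intervalIntegrable_integrandB (hα : 0 < α) (N : ℕ) {κ : ℂ} (hκ : κ ∈ domainB) :
    IntervalIntegrable (integrandB α N κ) volume (-(Real.pi / 2)) (Real.pi / 2) := by
  rw [intervalIntegrable_iff_integrableOn_Ioo_of_le (by linarith [Real.pi_pos])]
  exact integrableOn_momentIntegrand_ofReal hα N (by simpa using mul_pos hα hκ)

theorem re_neg_mul_add_natCast_sub_one_lt (hα : 0 < α) (N : ℕ) {κ : ℂ} (hκ : -(1 / α) < κ.re) :
    (-α * (κ + N) - 1 : ℂ).re < -(α * N) := by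
  rw [neg_lt, lt_div_iff₀ hα] at hκ
  simp only [Complex.sub_re, Complex.mul_re, Complex.neg_re, Complex.neg_im, Complex.ofReal_re,
    Complex.ofReal_im, Complex.add_re, Complex.natCast_re, Complex.one_re]
  linarith

theorem integrable_integrandA (hα : 0 < α) (N : ℕ) {κ : ℂ} (hκ : -(1 / α) < κ.re) :
    Integrable (integrandA α N κ) :=
  integrable_momentIntegrand_I_mul hα N
    (by linarith [re_neg_mul_add_natCast_sub_one_lt hα N hκ])

theorem isMeromorphicExtension_tildeB (hα : 0 < α) (N : ℕ) :
    IsMeromorphicExtension domainB (integralB α N) (fun κ ↦ tildeB α (κ + N) κ) := by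
  obtain ⟨g, hg, hgM⟩ := exists_meromorphic_eqOn_realMoment hα N
  have hcont {s : ℂ} (hs : s.re ∈ Ioi (-1)) : ContinuousAt g s :=
    ((differentiableOn_realMoment hα N).congr hgM).continuousOn.continuousAt
      ((isOpen_Ioi.preimage Complex.continuous_re).mem_nhds hs)
  have hre {κ : ℂ} (hκ : κ ∈ domainB) : (α * κ - 1 : ℂ).re ∈ Ioi (-1) := by
    simpa using mul_pos hα hκ
  have := Meromorphic.Gamma
  simpa only [tildeB_add_natCast] using isMeromorphicExtension_meromorphicExtension
    (g := fun κ ↦ (Complex.Gamma κ)⁻¹ * g (α * κ - 1)) (fun x ↦ by fun_prop)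
    (fun κ hκ ↦ by simp only [integralB_eq_realMoment, hgM (hre hκ)])
    fun κ hκ ↦ (Complex.differentiable_one_div_Gamma κ).continuousAt.mul
      ((hcont (hre hκ)).comp (f := fun κ : ℂ ↦ (α : ℂ) * κ - 1) (by fun_prop))

theorem isMeromorphicExtension_tildeA (hα : 0 < α) (N : ℕ) :
    IsMeromorphicExtension (domainA α N) (integralA α N) (fun κ ↦ tildeA α (κ + N) κ) := by
  obtain ⟨g, hg, hgM⟩ := exists_meromorphic_eqOn_imagMoment hα N
  have hcont {s : ℂ} (hs : s.re ∈ Iio (-(α * N))) : ContinuousAt g s :=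
    ((differentiableOn_imagMoment hα N).congr hgM).continuousOn.continuousAt
      ((isOpen_Iio.preimage Complex.continuous_re).mem_nhds hs)
  have hre {κ : ℂ} (hκ : κ ∈ domainA α N) : (-α * (κ + N) - 1 : ℂ).re ∈ Iio (-(α * N)) :=
    re_neg_mul_add_natCast_sub_one_lt hα N hκ.1
  have := Meromorphic.Gamma
  simpa only [tildeA_add_natCast] using isMeromorphicExtension_meromorphicExtension
    (g := fun κ ↦ Complex.Gamma (κ + N + 1) * (α / (2 * Real.pi) * g (-α * (κ + N) - 1)))
    (fun x ↦ by fun_prop)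
    (fun κ hκ ↦ by simp only [integralA_eq_imagMoment, hgM (hre hκ)])
    fun κ hκ ↦ ((Complex.differentiableAt_Gamma _ hκ.2).continuousAt.comp
      (f := fun κ : ℂ ↦ κ + N + 1) (by fun_prop)).mul
      (continuousAt_const.mul ((hcont (hre hκ)).comp (f := fun κ : ℂ ↦ -(α : ℂ) * (κ + N) - 1)
        (by fun_prop)))

theorem meromorphic_tildeB (hα : 0 < α) {ν κ : ℂ → ℂ} (N : ℕ) (hκ : Differentiable ℂ κ)
    (hN : ∀ k, ν k - κ k = N) : Meromorphic fun k ↦ tildeB α (ν k) (κ k) := by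
  obtain rfl : ν = fun k ↦ κ k + N := funext fun k ↦ eq_add_of_sub_eq' (hN k)
  exact fun k ↦ ((isMeromorphicExtension_tildeB hα N).1.meromorphicOn _
    (mem_univ _)).comp_analyticAt (hκ.analyticAt k)

theorem meromorphic_tildeA (hα : 0 < α) {ν κ : ℂ → ℂ} (N : ℕ) (hκ : Differentiable ℂ κ)
    (hN : ∀ k, ν k - κ k = N) : Meromorphic fun k ↦ tildeA α (ν k) (κ k) := by
  obtain rfl : ν = fun k ↦ κ k + N := funext fun k ↦ eq_add_of_sub_eq' (hN k)
  exact fun k ↦ ((isMeromorphicExtension_tildeA hα N).1.meromorphicOn _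
    (mem_univ _)).comp_analyticAt (hκ.analyticAt k)

/-- `Γ(P) B{P + i, P}`: the quantity `B` without its Gamma factor. -/
def gammaFreeB (α : ℝ) (i : ℕ) (P : ℂ) : ℂ :=
  Complex.Gamma P * tildeB α (P + i) P

/-- `A[Q, Q - j] / Γ(Q + 1)`: the quantity `A` without its Gamma factor. -/
def gammaFreeA (α : ℝ) (j : ℕ) (Q : ℂ) : ℂ :=
  tildeA α Q (Q - j) / Complex.Gamma (Q + 1)

theorem meromorphic_gammaFreeB (hα : 0 < α) (i : ℕ) : Meromorphic (gammaFreeB α i) :=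
  Meromorphic.Gamma.mul (meromorphic_tildeB hα i (by fun_prop) fun P ↦ by ring)

theorem meromorphic_gammaFreeA (hα : 0 < α) (j : ℕ) : Meromorphic (gammaFreeA α j) :=
  (meromorphic_tildeA hα j (by fun_prop) fun Q ↦ by ring).div
    (Meromorphic.meromorphic_fun_comp_add_const_iff_meromorphic.2 Meromorphic.Gamma)

theorem gammaFreeB_eq_realMoment (hα : 0 < α) (i : ℕ) {P : ℂ} (hP : 0 < P.re) :
    gammaFreeB α i P = realMoment α i (α * P - 1) := by
  have hB : tildeB α (P + i) P = integralB α i P := (isMeromorphicExtension_tildeB hα i).2 hP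
  rw [gammaFreeB, hB, integralB_eq_realMoment,
    mul_inv_cancel_left₀ (Complex.Gamma_ne_zero_of_re_pos hP)]

theorem gammaFreeA_eq_imagMoment (hα : 0 < α) (j : ℕ) {Q : ℂ} (hQ : j < Q.re) :
    gammaFreeA α j Q = α / (2 * Real.pi) * imagMoment α j (-α * Q - 1) := by
  have hQ₁ : 0 < (Q + 1).re := by
    rw [Complex.add_re, Complex.one_re]
    linarith [j.cast_nonneg (α := ℝ)]
  have hdom : Q - j ∈ domainA α j := by
    refine ⟨?_, fun m h ↦ ?_⟩
    · rw [Complex.sub_re, Complex.natCast_re]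
      linarith [one_div_pos.2 hα]
    · rw [sub_add_cancel] at h
      rw [h, Complex.neg_re, Complex.natCast_re] at hQ₁
      linarith [m.cast_nonneg (α := ℝ)]
  have hA := (isMeromorphicExtension_tildeA hα j).2 hdom
  simp only [sub_add_cancel, integralA_eq_imagMoment] at hA
  rw [gammaFreeA, hA, mul_div_cancel_left₀ _ (Complex.Gamma_ne_zero_of_re_pos hQ₁)]

theorem gammaFreeB_recurrence_of_re_pos (hα : 0 < α) (i : ℕ) {P : ℂ} (hP : 0 < P.re) :
    P * gammaFreeB α i P - (P + 1 / α) * gammaFreeB α i (P + 2 / α) =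
      if 2 ≤ i then gammaFreeB α (i - 2) (P + 2) / (P + 1) else 0 := by
  have hα₀ : (α : ℂ) ≠ 0 := by exact_mod_cast hα.ne'
  have hP₁ : P + 1 ≠ 0 := fun h ↦ by
    have hre := congrArg Complex.re h
    simp only [Complex.add_re, Complex.one_re, Complex.zero_re] at hre
    linarith
  have hP₂ : 0 < (P + 2 / α).re := by
    rw [Complex.add_re, Complex.div_ofReal_re, Complex.re_ofNat]
    positivity
  have hrec := momentRecurrence_realMoment hα i (p := α * P) (by simpa using mul_pos hα hP)
  rw [MomentRecurrence, show α * P + 1 = α * (P + 2 / α) - 1 by field_simp; ring,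
    show α * P + 2 * α - 1 = α * (P + 2) - 1 by ring] at hrec
  rw [gammaFreeB_eq_realMoment hα i hP, gammaFreeB_eq_realMoment hα i hP₂,
    gammaFreeB_eq_realMoment hα _ (by simp only [Complex.add_re, Complex.re_ofNat]; positivity)]
  refine mul_left_cancel₀ hα₀ ?_
  split_ifs at hrec ⊢ <;> field_simp at hrec ⊢ <;> linear_combination -hrec

theorem gammaFreeB_recurrence (hα : 0 < α) (i : ℕ) : ∀ᶠ P in codiscrete ℂ,
    P * gammaFreeB α i P - (P + 1 / α) * gammaFreeB α i (P + 2 / α) =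
      if 2 ≤ i then gammaFreeB α (i - 2) (P + 2) / (P + 1) else 0 := by
  have := meromorphic_gammaFreeB hα
  exact eventually_codiscrete_eq_of_eqOn (U := {P | 0 < P.re}) (fun x ↦ by fun_prop)
    (by split_ifs <;> exact fun x ↦ by fun_prop) (isOpen_lt continuous_const Complex.continuous_re)
    ⟨1, by simp⟩ fun P hP ↦ gammaFreeB_recurrence_of_re_pos hα i hP

theorem gammaFreeA_recurrence_of_lt_re (hα : 0 < α) (j : ℕ) {Q : ℂ} (hQ : j + 2 / α < Q.re) :
    Q * gammaFreeA α j Q - (Q - 1 / α) * gammaFreeA α j (Q - 2 / α) =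
      if 2 ≤ j then gammaFreeA α (j - 2) (Q - 2) / (Q - 1) else 0 := by
  have hα₀ : (α : ℂ) ≠ 0 := by exact_mod_cast hα.ne'
  have hpi : (Real.pi : ℂ) ≠ 0 := by exact_mod_cast Real.pi_ne_zero
  have hdiv : 0 < 2 / α := by positivity
  have hrec := momentRecurrence_imagMoment hα j (p := -α * Q) (by
    have hαQ := mul_lt_mul_of_pos_left hQ hα
    rw [mul_add, mul_div_cancel₀ _ hα.ne'] at hαQ
    simp only [Complex.mul_re, Complex.neg_re, Complex.neg_im, Complex.ofReal_re,
      Complex.ofReal_im]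
    linarith)
  rw [MomentRecurrence, show -α * Q + 1 = -α * (Q - 2 / α) - 1 by field_simp; ring,
    show -α * Q + 2 * α - 1 = -α * (Q - 2) - 1 by ring] at hrec
  rw [gammaFreeA_eq_imagMoment hα j (by linarith), gammaFreeA_eq_imagMoment hα j (by
    rw [Complex.sub_re, Complex.div_ofReal_re, Complex.re_ofNat]; linarith)]
  refine mul_left_cancel₀ hα₀ ?_
  split_ifs at hrec ⊢ with hj
  · have hQ₁ : Q - 1 ≠ 0 := fun h ↦ by
      have hre := congrArg Complex.re h
      have hj' : (2 : ℝ) ≤ j := by exact_mod_cast hj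
      simp only [Complex.sub_re, Complex.one_re, Complex.zero_re] at hre
      linarith
    have hQ₁' : 1 - Q ≠ 0 := sub_ne_zero.2 (sub_ne_zero.1 hQ₁).symm
    rw [gammaFreeA_eq_imagMoment hα _ (by
      rw [Complex.sub_re, Complex.re_ofNat, Nat.cast_sub hj]; push_cast; linarith)]
    rw [show -α * Q + α = -α * (Q - 1) by ring] at hrec
    field_simp at hrec ⊢
    linear_combination hrec
  · field_simp at hrec ⊢
    linear_combination hrec

theorem gammaFreeA_recurrence (hα : 0 < α) (j : ℕ) : ∀ᶠ Q in codiscrete ℂ,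
    Q * gammaFreeA α j Q - (Q - 1 / α) * gammaFreeA α j (Q - 2 / α) =
      if 2 ≤ j then gammaFreeA α (j - 2) (Q - 2) / (Q - 1) else 0 := by
  have := meromorphic_gammaFreeA hα
  exact eventually_codiscrete_eq_of_eqOn (U := {Q | j + 2 / α < Q.re}) (fun x ↦ by fun_prop)
    (by split_ifs <;> exact fun x ↦ by fun_prop) (isOpen_lt continuous_const Complex.continuous_re)
    ⟨((j + 2 / α + 1 : ℝ) : ℂ), by simp [-Complex.ofReal_add]⟩
    fun Q hQ ↦ gammaFreeA_recurrence_of_lt_re hα j hQ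

end BA

/-! ### The two identities -/

section Identities

variable {α : ℝ}

/-- The summands on the left-hand sides, where `ν = n`, `μ = m` and `κ = k`. -/
def shiftedProduct (α : ℝ) (ν μ κ : ℂ) : ℂ :=
  tildeB α ν μ * ((μ - 1 / α) * Complex.Gamma μ / Complex.Gamma (μ + 1 - 2 / α))
    * tildeA α (μ - 2 / α) (κ - 2 / α)

/-- The summands on the right-hand sides. -/
def directProduct (α : ℝ) (ν μ κ : ℂ) : ℂ :=
  tildeB α ν μ * tildeA α μ κ

/-- The common form of the summands of both sides, free of Gamma factors: the left-hand sides have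
`Q = P - 2 / α` and the right-hand sides have `Q = P`. -/
def mixedTerm (α : ℝ) (i j : ℕ) (P Q : ℂ) : ℂ :=
  (P + Q) / 2 * (gammaFreeB α i P * gammaFreeA α j Q)

theorem meromorphic_directProduct (hα : 0 < α) {ν μ κ : ℂ → ℂ} (i j : ℕ)
    (hμ : Differentiable ℂ μ) (hκ : Differentiable ℂ κ) (hi : ∀ k, ν k - μ k = i)
    (hj : ∀ k, μ k - κ k = j) : Meromorphic fun k ↦ directProduct α (ν k) (μ k) (κ k) :=
  (meromorphic_tildeB hα i hμ hi).mul (meromorphic_tildeA hα j hκ hj)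

theorem meromorphic_shiftedProduct (hα : 0 < α) {ν μ κ : ℂ → ℂ} (i j : ℕ)
    (hμ : Differentiable ℂ μ) (hκ : Differentiable ℂ κ) (hi : ∀ k, ν k - μ k = i)
    (hj : ∀ k, μ k - κ k = j) : Meromorphic fun k ↦ shiftedProduct α (ν k) (μ k) (κ k) := by
  have hΓ {f : ℂ → ℂ} (hf : Differentiable ℂ f) : Meromorphic fun k ↦ Complex.Gamma (f k) :=
    fun k ↦ (Meromorphic.Gamma _).comp_analyticAt (hf.analyticAt k)
  have hμ₁ : Meromorphic fun k ↦ μ k - 1 / α := fun k ↦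
    ((hμ.sub_const _).analyticAt k).meromorphicAt
  exact ((meromorphic_tildeB hα i hμ hi).mul ((hμ₁.mul (hΓ hμ)).div (hΓ (by fun_prop)))).mul
    (meromorphic_tildeA hα j (by fun_prop) fun k ↦ by rw [← hj k]; ring)

theorem shiftedProduct_eq_mixedTerm {ν μ κ : ℂ} {i j : ℕ} (hi : ν - μ = i) (hj : μ - κ = j) :
    shiftedProduct α ν μ κ = mixedTerm α i j μ (μ - 2 / α) := by
  rw [eq_add_of_sub_eq' hi, show κ = μ - j by rw [← hj]; ring, shiftedProduct, mixedTerm,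
    gammaFreeB, gammaFreeA, sub_add_eq_add_sub μ, sub_right_comm μ]
  ring

theorem eventually_directProduct_eq_mixedTerm : ∀ᶠ μ : ℂ in codiscrete ℂ,
    ∀ (ν κ : ℂ) (i j : ℕ), ν - μ = i → μ - κ = j →
      directProduct α ν μ κ = mixedTerm α i j μ μ := by
  filter_upwards [eventually_codiscrete_Gamma_ne_zero, eventually_codiscrete_ne 0]
    with μ hΓ h₀ ν κ i j hi hj
  rw [eq_add_of_sub_eq' hi, show κ = μ - j by rw [← hj]; ring, directProduct, mixedTerm,
    gammaFreeB, gammaFreeA, Complex.Gamma_add_one _ h₀]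
  field_simp
  ring

theorem mixedTerm_sub_mixedTerm_left (hα : 0 < α) (i j : ℕ) : ∀ᶠ P in codiscrete ℂ,
    mixedTerm α i j P P - mixedTerm α i j P (P - 2 / α) =
      if 2 ≤ j then gammaFreeB α i P * gammaFreeA α (j - 2) (P - 2) / (P - 1) else 0 := by
  filter_upwards [gammaFreeA_recurrence hα j] with P hP
  have h := congrArg (gammaFreeB α i P * ·) hP
  simp only [mul_ite, mul_zero, ← mul_div_assoc] at h
  rw [← h, mixedTerm, mixedTerm]
  ring

theorem mixedTerm_sub_mixedTerm_right (hα : 0 < α) (i j : ℕ) : ∀ᶠ P in codiscrete ℂ,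
    mixedTerm α i j P P - mixedTerm α i j (P + 2 / α) P =
      if 2 ≤ i then gammaFreeB α (i - 2) (P + 2) * gammaFreeA α j P / (P + 1) else 0 := by
  filter_upwards [gammaFreeB_recurrence hα i] with P hP
  have h := congrArg (· * gammaFreeA α j P) hP
  simp only [ite_mul, zero_mul, div_mul_eq_mul_div] at h
  rw [← h, mixedTerm, mixedTerm]
  ring

theorem mixedTerm_exchange (hα : 0 < α) (i j : ℕ) : ∀ᶠ P in codiscrete ℂ,
    mixedTerm α i (j + 2) P (P - 2 / α) - mixedTerm α i (j + 2) P P =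
      mixedTerm α (i + 2) j (P - 2 + 2 / α) (P - 2) - mixedTerm α (i + 2) j (P - 2) (P - 2) := by
  filter_upwards [mixedTerm_sub_mixedTerm_left hα i (j + 2),
    (tendsto_add_const_codiscrete (-2)).eventually
      (mixedTerm_sub_mixedTerm_right hα (i + 2) j)] with P hleft hright
  rw [if_pos (by omega), Nat.add_sub_cancel] at hleft hright
  rw [← sub_eq_add_neg, sub_add_cancel, show P - 2 + 1 = P - 1 by ring] at hright
  rw [← neg_sub, hleft, ← neg_sub (mixedTerm _ _ _ _ _), hright]

theorem sum_mixedTerm_eq_downward (hα : 0 < α) (a b : ℕ) : ∀ᶠ d : ℂ in codiscrete ℂ,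
    ∑ t ∈ Finset.range (b / 2 + 1),
        mixedTerm α (a + 2 * t) (b - 2 * t) (d - 2 * t) (d - 2 * t - 2 / α) =
      ∑ t ∈ Finset.range (b / 2 + 1), mixedTerm α (a + 2 * t) (b - 2 * t)
        (d + t • (2 / α : ℂ) - 2 * t) (d + t • (2 / α : ℂ) - 2 * t) := by
  refine eventually_sum_eq_sum_diagonal (tendsto_add_const_codiscrete (2 / α)) (b / 2 + 1)
    (fun t d ↦ mixedTerm α (a + 2 * t) (b - 2 * t) (d - 2 * t) (d - 2 * t - 2 / α))
    (fun t d ↦ mixedTerm α (a + 2 * t) (b - 2 * t) (d - 2 * t) (d - 2 * t))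
    (fun t ht ↦ ?_) fun t ht ↦ ?_
  · filter_upwards [(tendsto_add_const_codiscrete (-(2 * t))).eventually
      (mixedTerm_exchange hα (a + 2 * t) (b - 2 * (t + 1)))] with d hd
    rw [← sub_eq_add_neg] at hd
    have hP : d + 2 / α - 2 * (t + 1 : ℕ) = d - 2 * t - 2 + 2 / α := by push_cast; ring
    have hQ : d - 2 * (t + 1 : ℕ) = d - 2 * t - 2 := by push_cast; ring
    rw [show b - 2 * t = b - 2 * (t + 1) + 2 by omega, hd, hP, hQ, add_sub_cancel_right,
      mul_add_one, ← add_assoc]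
  · filter_upwards [(tendsto_add_const_codiscrete (-(2 * t))).eventually
      (mixedTerm_sub_mixedTerm_left hα (a + 2 * t) (b - 2 * t))] with d hd
    rw [← sub_eq_add_neg, if_neg (by omega)] at hd
    exact (sub_eq_zero.1 hd).symm

theorem sum_mixedTerm_eq_upward (hα : 0 < α) (a b : ℕ) : ∀ᶠ d : ℂ in codiscrete ℂ,
    ∑ t ∈ Finset.range (a / 2), mixedTerm α (a - 2 * (t + 1)) (b + 2 * (t + 1))
        (d + 2 * (t + 1)) (d + 2 * (t + 1) - 2 / α) =
      ∑ t ∈ Finset.range (a / 2), mixedTerm α (a - 2 * (t + 1)) (b + 2 * (t + 1))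
        (d + t • (-(2 / α) : ℂ) + 2 * (t + 1) - 2 / α)
        (d + t • (-(2 / α) : ℂ) + 2 * (t + 1) - 2 / α) := by
  refine eventually_sum_eq_sum_diagonal (tendsto_add_const_codiscrete (-(2 / α))) (a / 2)
    (fun t d ↦ mixedTerm α (a - 2 * (t + 1)) (b + 2 * (t + 1))
      (d + 2 * (t + 1)) (d + 2 * (t + 1) - 2 / α))
    (fun t d ↦ mixedTerm α (a - 2 * (t + 1)) (b + 2 * (t + 1))
      (d + 2 * (t + 1) - 2 / α) (d + 2 * (t + 1) - 2 / α))
    (fun t ht ↦ ?_) fun t ht ↦ ?_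
  · filter_upwards [(tendsto_add_const_codiscrete (2 * (t + 2) - 2 / α)).eventually
      (mixedTerm_exchange hα (a - 2 * (t + 1 + 1)) (b + 2 * (t + 1)))] with d hd
    have hP : d + (2 * (t + 2) - 2 / α) - 2 + 2 / α = d + 2 * (t + 1) := by ring
    have hQ : d + (2 * (t + 2) - 2 / α) - 2 = d + 2 * (t + 1) - 2 / α := by ring
    have hP' : d + -(2 / α) + 2 * ((t + 1 : ℕ) + 1) = d + (2 * (t + 2) - 2 / α) := by
      push_cast; ring
    have hQ' : d + 2 * ((t + 1 : ℕ) + 1) - 2 / α = d + (2 * (t + 2) - 2 / α) := by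
      push_cast; ring
    rw [hP, hQ, show a - 2 * (t + 1 + 1) + 2 = a - 2 * (t + 1) by omega] at hd
    rw [← hd, hP', hQ', mul_add_one 2 (t + 1), ← add_assoc b]
  · filter_upwards [(tendsto_add_const_codiscrete (2 * (t + 1) - 2 / α)).eventually
      (mixedTerm_sub_mixedTerm_right hα (a - 2 * (t + 1)) (b + 2 * (t + 1)))] with d hd
    rw [← add_sub_assoc, sub_add_cancel, if_neg (by omega)] at hd
    exact (sub_eq_zero.1 hd).symm

theorem sum_shiftedProduct_eq_downward (hα : 0 < α) (a b : ℕ) : ∀ᶠ k : ℂ in codiscrete ℂ,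
    ∑ s ∈ (Finset.range (b + 1)).filter Even, shiftedProduct α (k + b + a) (k + b - s) k =
      ∑ q ∈ (Finset.range (b + 1)).filter Even,
        directProduct α (k + b + a + q / α) (k + b - q + q / α) (k + q / α) := by
  have hdirect := (eventually_all_finset (Finset.range (b / 2 + 1))).2 fun t _ ↦
    (tendsto_add_const_codiscrete (b - (2 * t : ℕ) + (2 * t : ℕ) / α)).eventually
      (eventually_directProduct_eq_mixedTerm (α := α))
  filter_upwards [hdirect, (tendsto_add_const_codiscrete b).eventually
    (sum_mixedTerm_eq_downward hα a b)] with k hdirect hsum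
  have hcast {t : ℕ} (ht : t ∈ Finset.range (b / 2 + 1)) :
      ((b - 2 * t : ℕ) : ℂ) = b - 2 * t := by
    rw [Nat.cast_sub (by have := Finset.mem_range.1 ht; omega)]
    push_cast
    ring
  rw [sum_filter_even_range, sum_filter_even_range]
  convert hsum using 1 <;> refine Finset.sum_congr rfl fun t ht ↦ ?_
  · rw [shiftedProduct_eq_mixedTerm (i := a + 2 * t) (j := b - 2 * t) (by push_cast; ring)
      (by rw [hcast ht]; push_cast; ring)]
    push_cast
    rfl
  · have hP : k + b + t • (2 / α : ℂ) - 2 * t = k + (b - (2 * t : ℕ) + (2 * t : ℕ) / α) := by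
      rw [nsmul_eq_mul]; push_cast; ring
    rw [hP, ← hdirect t ht (k + b + a + (2 * t : ℕ) / α) (k + (2 * t : ℕ) / α) _ _
      (by push_cast; ring) (by rw [hcast ht]; push_cast; ring), ← add_assoc, ← add_sub_assoc]

theorem sum_shiftedProduct_eq_upward (hα : 0 < α) (a b : ℕ) : ∀ᶠ k : ℂ in codiscrete ℂ,
    ∑ s ∈ (Finset.Icc 2 a).filter Even, shiftedProduct α (k + b + a) (k + b + s) k =
      ∑ q ∈ (Finset.Icc 2 a).filter Even,
        directProduct α (k + b + a - q / α) (k + b + q - q / α) (k - q / α) := by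
  have hdirect := (eventually_all_finset (Finset.range (a / 2))).2 fun t _ ↦
    (tendsto_add_const_codiscrete (b + (2 * (t + 1) : ℕ) - (2 * (t + 1) : ℕ) / α)).eventually
      (eventually_directProduct_eq_mixedTerm (α := α))
  filter_upwards [hdirect, (tendsto_add_const_codiscrete b).eventually
    (sum_mixedTerm_eq_upward hα a b)] with k hdirect hsum
  have hcast {t : ℕ} (ht : t ∈ Finset.range (a / 2)) :
      ((a - 2 * (t + 1) : ℕ) : ℂ) = a - 2 * (t + 1) := by
    rw [Nat.cast_sub (by have := Finset.mem_range.1 ht; omega)]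
    push_cast
    ring
  rw [sum_filter_even_Icc_two, sum_filter_even_Icc_two]
  convert hsum using 1 <;> refine Finset.sum_congr rfl fun t ht ↦ ?_
  · rw [shiftedProduct_eq_mixedTerm (i := a - 2 * (t + 1)) (j := b + 2 * (t + 1))
      (by rw [hcast ht]; push_cast; ring) (by push_cast; ring)]
    push_cast
    rfl
  · have hP : k + b + t • (-(2 / α) : ℂ) + 2 * (t + 1) - 2 / α =
        k + (b + (2 * (t + 1) : ℕ) - (2 * (t + 1) : ℕ) / α) := by
      rw [nsmul_eq_mul]; push_cast; ring
    rw [hP, ← hdirect t ht (k + b + a - (2 * (t + 1) : ℕ) / α) (k - (2 * (t + 1) : ℕ) / α) _ _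
      (by rw [hcast ht]; push_cast; ring) (by push_cast; ring), ← add_sub_assoc, ← add_assoc]

theorem eqAsMeromorphic_downward (hα : 0 < α) (a b : ℕ) :
    EqAsMeromorphic
      (fun k ↦ ∑ s ∈ (Finset.range (b + 1)).filter Even,
        shiftedProduct α (k + b + a) (k + b - s) k)
      (fun k ↦ ∑ q ∈ (Finset.range (b + 1)).filter Even,
        directProduct α (k + b + a + q / α) (k + b - q + q / α) (k + q / α)) := by
  have hcast {s : ℕ} (hs : s ∈ (Finset.range (b + 1)).filter Even) : ((b - s : ℕ) : ℂ) = b - s :=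
    Nat.cast_sub (Nat.lt_succ_iff.1 (Finset.mem_range.1 (Finset.mem_filter.1 hs).1))
  refine ⟨fun x _ ↦ MeromorphicAt.fun_sum fun s hs ↦ Meromorphic.meromorphicAt ?_,
    fun x _ ↦ MeromorphicAt.fun_sum fun q hq ↦ Meromorphic.meromorphicAt ?_,
    sum_shiftedProduct_eq_downward hα a b⟩
  · refine meromorphic_shiftedProduct hα (a + s) (b - s) (by fun_prop) (by fun_prop) (fun k ↦ ?_)
      fun k ↦ ?_
    · push_cast
      ring
    · rw [hcast hs]
      ring
  · refine meromorphic_directProduct hα (a + q) (b - q) (by fun_prop) (by fun_prop) (fun k ↦ ?_)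
      fun k ↦ ?_
    · push_cast
      ring
    · rw [hcast hq]
      ring

theorem eqAsMeromorphic_upward (hα : 0 < α) (a b : ℕ) :
    EqAsMeromorphic
      (fun k ↦ ∑ s ∈ (Finset.Icc 2 a).filter Even,
        shiftedProduct α (k + b + a) (k + b + s) k)
      (fun k ↦ ∑ q ∈ (Finset.Icc 2 a).filter Even,
        directProduct α (k + b + a - q / α) (k + b + q - q / α) (k - q / α)) := by
  have hcast {s : ℕ} (hs : s ∈ (Finset.Icc 2 a).filter Even) : ((a - s : ℕ) : ℂ) = a - s :=
    Nat.cast_sub (Finset.mem_Icc.1 (Finset.mem_filter.1 hs).1).2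
  refine ⟨fun x _ ↦ MeromorphicAt.fun_sum fun s hs ↦ Meromorphic.meromorphicAt ?_,
    fun x _ ↦ MeromorphicAt.fun_sum fun q hq ↦ Meromorphic.meromorphicAt ?_,
    sum_shiftedProduct_eq_upward hα a b⟩
  · refine meromorphic_shiftedProduct hα (a - s) (b + s) (by fun_prop) (by fun_prop) (fun k ↦ ?_)
      fun k ↦ ?_
    · rw [hcast hs]
      ring
    · push_cast
      ring
  · refine meromorphic_directProduct hα (a - q) (b + q) (by fun_prop) (by fun_prop) (fun k ↦ ?_)
      fun k ↦ ?_
    · rw [hcast hq]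
      ring
    · push_cast
      ring

end Identities

end BetaPrime

end

theorem theorem3p3 (α : ℝ) (hα : 0 < α) :
    -- the quantities are well defined: the integrals converge and have meromorphic extensions
    (∀ N : ℕ,
      (∀ κ ∈ BetaPrime.domainB, IntervalIntegrable (BetaPrime.integrandB α N κ)
        MeasureTheory.volume (-(Real.pi / 2)) (Real.pi / 2)) ∧
      BetaPrime.IsMeromorphicExtension BetaPrime.domainB (BetaPrime.integralB α N)
        (fun κ => BetaPrime.tildeB α (κ + N) κ)) ∧
    (∀ N : ℕ,
      (∀ κ : ℂ, -(1 / α) < κ.re → MeasureTheory.Integrable (BetaPrime.integrandA α N κ)) ∧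
      BetaPrime.IsMeromorphicExtension (BetaPrime.domainA α N) (BetaPrime.integralA α N)
        (fun κ => BetaPrime.tildeA α (κ + N) κ)) ∧
    -- the two identities, with `n - d = a` and `d - k = b` fixed
    (∀ a b : ℕ,
      BetaPrime.EqAsMeromorphic
        (fun k : ℂ =>
          let d : ℂ := k + b
          let n : ℂ := d + a
          ∑ s ∈ (Finset.range (b + 1)).filter Even,
            let m : ℂ := d - s
            BetaPrime.tildeB α n m
              * ((m - 1 / α) * Complex.Gamma m / Complex.Gamma (m + 1 - 2 / α))
              * BetaPrime.tildeA α (m - 2 / α) (k - 2 / α))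
        (fun k : ℂ =>
          let d : ℂ := k + b
          let n : ℂ := d + a
          ∑ q ∈ (Finset.range (b + 1)).filter Even,
            BetaPrime.tildeB α (n + q / α) (d - q + q / α)
              * BetaPrime.tildeA α (d - q + q / α) (k + q / α)) ∧
      BetaPrime.EqAsMeromorphic
        (fun k : ℂ =>
          let d : ℂ := k + b
          let n : ℂ := d + a
          ∑ s ∈ (Finset.Icc 2 a).filter Even,
            let m : ℂ := d + s
            BetaPrime.tildeB α n m
              * ((m - 1 / α) * Complex.Gamma m / Complex.Gamma (m + 1 - 2 / α))
              * BetaPrime.tildeA α (m - 2 / α) (k - 2 / α))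
        (fun k : ℂ =>
          let d : ℂ := k + b
          let n : ℂ := d + a
          ∑ q ∈ (Finset.Icc 2 a).filter Even,
            BetaPrime.tildeB α (n - q / α) (d + q - q / α)
              * BetaPrime.tildeA α (d + q - q / α) (k - q / α))) := by
  exact ⟨fun N ↦ ⟨fun _ ↦ BetaPrime.intervalIntegrable_integrandB hα N,
      BetaPrime.isMeromorphicExtension_tildeB hα N⟩,
    fun N ↦ ⟨fun _ ↦ BetaPrime.integrable_integrandA hα N,
      BetaPrime.isMeromorphicExtension_tildeA hα N⟩,
    fun a b ↦ ⟨BetaPrime.eqAsMeromorphic_downward hα a b,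
      BetaPrime.eqAsMeromorphic_upward hα a b⟩⟩
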